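/- For $1\le p\le\infty$ and $x\in\mathbb R^n$ let $\|x\|_p=(\sum_{i}|x_i|^p)^{1/p}$ if $p<\infty$, $\|x\|_\infty=\max_i|x_i|$, and $\mathbb B_p^n=\{x\in\mathbb R^n:\|x\|_p\le 1\}$. For $r,s\ge 0$ put $$M_p(r)=\frac{p^{r/p}}{r+1}\,\frac{\Gamma(1+\frac{r+1}{p})}{\Gamma(1+\frac1p)}\quad(p<\infty),\qquad M_\infty(r)=\frac1{r+1},\qquad C_p(r,s)=M_p(r+s)-M_p(r)M_p(s),$$ with the conventions $1/\infty=0$, $M_\infty(\infty)=0$ and $C_\infty(\infty,\infty)=C_\infty(\infty,q)=C_\infty(q,\infty)=0$. **Theorem 1.1.** Let $1\le p\le\infty$, $d\in\mathbb N$, $1\le q_1<\dots<q_d\le\infty$, and for each $n\in\mathbb N$ let $Z=Z_n$ be a random vector uniformly distributed in $\mathbb B_p^n$. All limits are in distribution as $n\to\infty$. (a) If $p\ne q_i$ for all $i\in\{1,\dots,d\}$ and $q_d<\infty$, then $$\sqrt n\,\Big(n^{1/p-1/q_i}\frac{\|Z\|_{q_i}}{M_p(q_i)^{1/q_i}}-1\Big)_{i=1}^d\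 \longrightarrow\ N,$$ where $N$ is a centered Gaussian random vector with covariance matrix $(c_{ij})_{i,j=1}^d$, $$c_{ij}=\frac{C_p(q_i,q_j)}{q_iq_jM_p(q_i)M_p(q_j)}+\frac{C_p(p,p)}{p^2}-\frac1p\Big(\frac{C_p(q_i,p)}{q_iM_p(q_i)}+\frac{C_p(q_j,p)}{q_jM_p(q_j)}\Big),$$ that is, $$c_{ij}=\frac1{q_iq_j}\Big(\frac{\Gamma(\frac1p)\,\Gamma(\frac{q_i+q_j+1}{p})}{\Gamma(\frac{q_i+1}{p})\,\Gamma(\frac{q_j+1}{p})}-1\Big)-\frac1p\quad\text{if }p<\infty,\qquad c_{ij}=\frac1{q_i+q_j+1}\quad\text{if }p=\infty.$$ (b) If $d=1$ and $p=q:=q_1\in[1,\infty]$, then $n(1-\|Z\|_q)\longrightarrow E$, where $E$ is an exponential random variable with mean $1$. (c) If $d=1$ and $p\in[1,\infty)$, then $$\frac{n^{1/p}}{(p\log n)^{\frac1p-1}}\,\|Z\|_\infty-A_n^{(p)}\ \longrightarrow\ G,\qquad A_n^{(p)}=p\log n+\frac1p\Big((1-p)\log(p\log n)+p\log K\Big),\qquad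 K=\frac1{p^{1/p}\,\Gamma(1+\frac1p)},$$ where $G$ is a Gumbel random variable with distribution function $F_G(t)=e^{-e^{-t}}$, $t\in\mathbb R$. -/

import Mathlib

open MeasureTheory ProbabilityTheory Filter Topology Set
open scoped ENNReal

namespace LpBall

noncomputable section

/-- The `ℓ_p` norm on `ℝⁿ`, `1 ≤ p ≤ ∞` (the norm of `PiLp p`). -/
def lpNorm {n : ℕ} (p : ℝ≥0∞) (x : Fin n → ℝ) : ℝ := ‖WithLp.toLp p x‖

theorem lpNorm_of_ne_top {n : ℕ} {p : ℝ≥0∞} (hp : 1 ≤ p) (hp' : p ≠ ∞) (x : Fin n → ℝ) :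
    lpNorm p x = (∑ i, |x i| ^ p.toReal) ^ (1 / p.toReal) := by
  have h : 0 < p.toReal := ENNReal.toReal_pos (by positivity) hp'
  simp [lpNorm, PiLp.norm_eq_sum h]

theorem lpNorm_top {n : ℕ} (x : Fin n → ℝ) : lpNorm ∞ x = ⨆ i, |x i| := by
  simp [lpNorm, PiLp.norm_eq_ciSup]

/-- The closed unit ball of `ℓ_p` in `ℝⁿ`. -/
def unitBall (n : ℕ) (p : ℝ≥0∞) : Set (Fin n → ℝ) := {x | lpNorm p x ≤ 1}

/-- The quantity `M_p(r)` for `1 ≤ p ≤ ∞`. For `p = ∞` and finite `r` it is `1 / (r + 1)`, with the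
convention `M_∞(∞) = 0`. (For `p < ∞` only finite `r` are meaningful.) -/
def M (p r : ℝ≥0∞) : ℝ :=
  if p = ∞ then
    if r = ∞ then 0 else 1 / (r.toReal + 1)
  else
    p.toReal ^ (r.toReal / p.toReal) / (r.toReal + 1) *
      (Real.Gamma (1 + (r.toReal + 1) / p.toReal) / Real.Gamma (1 + 1 / p.toReal))

/-- The quantity `C_p(r, s) = M_p(r + s) - M_p(r) M_p(s)`. By the convention `M_∞(∞) = 0` it
satisfies `C_∞(∞, ∞) = C_∞(∞, q) = 0`, see `C_top_left`. -/
def C (p r s : ℝ≥0∞) : ℝ := M p (r + s) - M p r * M p s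

theorem C_top_left (s : ℝ≥0∞) : C ∞ ∞ s = 0 := by simp [C, M]

theorem C_top_right (r : ℝ≥0∞) : C ∞ r ∞ = 0 := by simp [C, M]

/-- The matrix `(c_ij)` of the limiting Gaussian vector. Here `p⁻¹.toReal` is `1 / p`, which is `0`
for `p = ∞`. -/
def limitCov {d : ℕ} (p : ℝ≥0∞) (q : Fin d → ℝ≥0∞) : Matrix (Fin d) (Fin d) ℝ :=
  Matrix.of fun i j =>
    C p (q i) (q j) / ((q i).toReal * (q j).toReal * M p (q i) * M p (q j))
      + p⁻¹.toReal ^ 2 * C p p p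
      - p⁻¹.toReal *
        (C p (q i) p / ((q i).toReal * M p (q i)) + C p (q j) p / ((q j).toReal * M p (q j)))

/-- The Gumbel distribution function `t ↦ exp (-exp (-t))`. -/
def gumbelFunction : StieltjesFunction ℝ where
  toFun t := Real.exp (-Real.exp (-t))
  mono' := by
    intro a b hab
    simp only [Real.exp_le_exp, neg_le_neg_iff]
    exact hab
  right_continuous' x := by
    have : Continuous fun t : ℝ => Real.exp (-Real.exp (-t)) := by fun_prop
    exact this.continuousWithinAt

/-- The Gumbel distribution on `ℝ`. -/
def gumbelMeasure : Measure ℝ := gumbelFunction.measure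

theorem gumbelFunction_tendsto_atBot : Tendsto gumbelFunction atBot (𝓝 0) :=
  Real.tendsto_exp_atBot.comp
    (tendsto_neg_atTop_atBot.comp (Real.tendsto_exp_atTop.comp tendsto_neg_atBot_atTop))

theorem gumbelFunction_tendsto_atTop : Tendsto gumbelFunction atTop (𝓝 1) := by
  have h : Tendsto (fun t : ℝ => Real.exp (-Real.exp (-t))) atTop (𝓝 (Real.exp (-0))) :=
    (Real.continuous_exp.tendsto _).comp
      ((Real.tendsto_exp_atBot.comp tendsto_neg_atTop_atBot).neg)
  rw [neg_zero, Real.exp_zero] at h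
  exact h

instance isProbabilityMeasure_gumbelMeasure : IsProbabilityMeasure gumbelMeasure :=
  gumbelFunction.isProbabilityMeasure gumbelFunction_tendsto_atBot gumbelFunction_tendsto_atTop

theorem cdf_gumbelMeasure (t : ℝ) : cdf gumbelMeasure t = Real.exp (-Real.exp (-t)) := by
  rw [gumbelMeasure, cdf_measure_stieltjesFunction _ gumbelFunction_tendsto_atBot
    gumbelFunction_tendsto_atTop]
  rfl

instance isProbabilityMeasure_expMeasure_one : IsProbabilityMeasure (expMeasure 1) :=
  isProbabilityMeasure_expMeasure one_pos

/-- The constant `K = 1 / (p^{1/p} Γ(1 + 1/p))`. -/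
def K (p : ℝ) : ℝ := 1 / (p ^ (1 / p) * Real.Gamma (1 + 1 / p))

/-- The centering sequence
`A_n^{(p)} = p log n + (1/p) ((1 - p) log (p log n) + p log K)`. -/
def A (p : ℝ) (n : ℕ) : ℝ :=
  p * Real.log n + 1 / p * ((1 - p) * Real.log (p * Real.log n) + p * Real.log (K p))

end

end LpBall

/-! Only the laws of the vectors `Z n` matter, so for (a) and (c) they may be replaced by an
explicit model. For `p < ∞` let `Y_1, Y_2, ...` be iid with density proportional to `exp (-|x| ^ p /
p)` and let `W` be an independent exponential variable of rate `1 / p`. Then `(∑ |Y_i| ^ p + W) ^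
(-1/p) • (Y_1, ..., Y_n)` is uniform on the ball (`map_ballPoint`). For `p = ∞` the coordinates are
iid uniform on `[-1, 1]` and no radial factor is needed.

(a) In the model the normalised `q`-norm is `S ^ (1/q) * (T + W/n) ^ (-1/p)`, where `S` is the
empirical mean of `|Y_k| ^ q / M_p(q)` and `T` that of `|Y_k| ^ p`, both of expectation 1. To first
order the fluctuation is the empirical mean of `(1/q) (|Y_k| ^ q / M_p(q) - 1) - (1/p) (|Y_k| ^ p -
1)`. The multivariate central limit theorem applies to these iid vectors, whose covariance is
`limitCov`. The remainder is `√n` times squared deviations of order `1/n`, plus `W / √n`, and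
vanishes in probability (`tendstoInDistribution_sqrt_mul_rpow_mul_rpow`).

(b) By scaling of Lebesgue measure `‖Z‖_p` has distribution function `ρ ^ n` on `(0, 1]`, and `1 -
(1 - t/n) ^ n` tends to `1 - exp (-t)`.

(c) For iid coordinates the maximum satisfies `P(max ≤ t) = (1 - P(|Y| > t)) ^ n`. Tail asymptotics
of Mills type give `n P(|Y| > t_n) → exp (-s)` at the threshold `t_n` of level `s`, hence the Gumbel
limit (`tendstoInDistribution_max_coord`). The radial factor is `1 + o(n ^ (-1/4))` in probability
while `A_n` grows like `log n`, so Slutsky's theorem carries the limit over to `Z`. -/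

namespace LpBall

/-! ### Criteria for convergence in distribution and in probability -/

section Convergence

/-- Half-open intervals form a π-system containing arbitrarily small neighbourhoods of each point,
and their masses are differences of distribution functions. Convergence is assumed at every `t`, so
continuity points play no role. -/
theorem tendstoInDistribution_of_tendsto_cdf {Ω : ℕ → Type*} [∀ n, MeasurableSpace (Ω n)]
    {P : ∀ n, Measure (Ω n)} [∀ n, IsProbabilityMeasure (P n)] {X : ∀ n, Ω n → ℝ}
    {μ : Measure ℝ} [IsProbabilityMeasure μ] (hX : ∀ n, AEMeasurable (X n) (P n))
    (h : ∀ t, Tendsto (fun n => (P n).real {ω | X n ω ≤ t}) atTop (𝓝 (cdf μ t))) :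
    TendstoInDistribution X atTop id P μ where
  forall_aemeasurable := hX
  tendsto := by
    refine (isPiSystem_Ioc (id : ℝ → ℝ) id).tendsto_probabilityMeasure_of_tendsto_of_mem ?_ ?_ ?_
    · rintro s ⟨a, b, -, rfl⟩
      exact measurableSet_Ioc
    · intro u hu x hx
      obtain ⟨ε, hε, hsub⟩ := Metric.isOpen_iff.1 hu x hx
      refine ⟨Ioc (x - ε / 2) (x + ε / 2), ⟨_, _, by simp; linarith, rfl⟩,
        Ioc_mem_nhds (by linarith) (by linarith), fun y hy => hsub ?_⟩
      rw [Metric.mem_ball, Real.dist_eq, abs_lt]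
      constructor <;> linarith [hy.1, hy.2]
    · rintro s ⟨a, b, hab, rfl⟩
      simp only [id_eq] at hab ⊢
      have key : ∀ (m : Measure ℝ) [IsProbabilityMeasure m],
          m.real (Ioc a b) = m.real (Iic b) - m.real (Iic a) := by
        intro m _
        rw [← measureReal_sdiff (Iic_subset_Iic.2 hab.le) measurableSet_Iic]
        congr 1
        ext y
        simp [and_comm]
      rw [← NNReal.tendsto_coe]
      change Tendsto (fun n => ((P n).map (X n)).real (Ioc a b)) atTop
        (𝓝 ((μ.map id).real (Ioc a b)))
      have : ∀ n, IsProbabilityMeasure ((P n).map (X n)) :=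
        fun n => Measure.isProbabilityMeasure_map (hX n)
      simp_rw [Measure.map_id, key]
      have h2 : ∀ n t, ((P n).map (X n)).real (Iic t) = (P n).real {ω | X n ω ≤ t} := by
        intro n t
        rw [map_measureReal_apply_of_aemeasurable (hX n) measurableSet_Iic]
        rfl
      simp_rw [h2, ← cdf_eq_real]
      exact (h b).sub (h a)

theorem TendstoInDistribution.of_map_eq {Ω : ℕ → Type*} [∀ n, MeasurableSpace (Ω n)]
    {P : ∀ n, Measure (Ω n)} [∀ n, IsProbabilityMeasure (P n)] {Ω' : ℕ → Type*}
    [∀ n, MeasurableSpace (Ω' n)]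
    {P' : ∀ n, Measure (Ω' n)} [∀ n, IsProbabilityMeasure (P' n)]
    {E : Type*} [TopologicalSpace E] [MeasurableSpace E] [OpensMeasurableSpace E]
    {μ : Measure E} [IsProbabilityMeasure μ] {X : ∀ n, Ω n → E} {X' : ∀ n, Ω' n → E}
    (hX : ∀ n, AEMeasurable (X n) (P n)) (heq : ∀ n, (P n).map (X n) = (P' n).map (X' n))
    (h : TendstoInDistribution X' atTop id P' μ) : TendstoInDistribution X atTop id P μ where
  forall_aemeasurable := hX
  tendsto := by
    refine h.tendsto.congr fun n => ?_
    exact Subtype.ext (heq n).symm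

theorem TendstoInDistribution.comp_of_map_eq {Ω : ℕ → Type*} [∀ n, MeasurableSpace (Ω n)]
    {P : ∀ n, Measure (Ω n)} [∀ n, IsProbabilityMeasure (P n)] {Ω' : ℕ → Type*}
    [∀ n, MeasurableSpace (Ω' n)]
    {P' : ∀ n, Measure (Ω' n)} [∀ n, IsProbabilityMeasure (P' n)]
    {E : Type*} [TopologicalSpace E] [MeasurableSpace E] [OpensMeasurableSpace E]
    {F : ℕ → Type*} [∀ n, MeasurableSpace (F n)]
    {μ : Measure E} [IsProbabilityMeasure μ] {X : ∀ n, Ω n → F n} {X' : ∀ n, Ω' n → F n}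
    {g : ∀ n, F n → E} (hg : ∀ n, Measurable (g n))
    (hX : ∀ n, AEMeasurable (X n) (P n)) (hX' : ∀ n, AEMeasurable (X' n) (P' n))
    (heq : ∀ n, (P n).map (X n) = (P' n).map (X' n))
    (h : TendstoInDistribution (fun n ω => g n (X' n ω)) atTop id P' μ) :
    TendstoInDistribution (fun n ω => g n (X n ω)) atTop id P μ := by
  refine TendstoInDistribution.of_map_eq (fun n => (hg n).comp_aemeasurable (hX n))
    (fun n => ?_) h
  change (P n).map (g n ∘ X n) = (P' n).map (g n ∘ X' n)
  rw [← AEMeasurable.map_map_of_aemeasurable (hg n).aemeasurable (hX n), heq,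
    AEMeasurable.map_map_of_aemeasurable (hg n).aemeasurable (hX' n)]

variable {Ω : Type*} [MeasurableSpace Ω] {P : Measure Ω}

/-- If smallness of `X n` forces smallness of `R n`, uniformly in `n`, then convergence in
probability of `X n` to `0` passes to `R n`. -/
theorem tendstoInMeasure_zero_of_small {E : Type*} [SeminormedAddCommGroup E]
    {X : ℕ → Ω → ℝ} {R : ℕ → Ω → E} (hX : TendstoInMeasure P X atTop 0)
    (h : ∀ ε > 0, ∃ δ > 0, ∀ᶠ n in atTop, ∀ ω, |X n ω| < δ → ‖R n ω‖ < ε) :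
    TendstoInMeasure P R atTop 0 := by
  rw [tendstoInMeasure_iff_norm] at hX ⊢
  intro ε hε
  obtain ⟨δ, hδ, hn⟩ := h ε hε
  refine tendsto_of_tendsto_of_tendsto_of_le_of_le' tendsto_const_nhds (hX δ hδ)
    (Eventually.of_forall fun _ => zero_le) ?_
  filter_upwards [hn] with n hn
  refine measure_mono fun ω hω => ?_
  simp only [Pi.zero_apply, sub_zero, mem_ofPred_eq] at hω ⊢
  by_contra hlt
  exact absurd (hn ω (not_le.1 hlt)) (not_lt.2 hω)

theorem tendstoInMeasure_zero_add {X Y : ℕ → Ω → ℝ} (hX : TendstoInMeasure P X atTop 0)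
    (hY : TendstoInMeasure P Y atTop 0) :
    TendstoInMeasure P (fun n ω => X n ω + Y n ω) atTop 0 := by
  rw [tendstoInMeasure_iff_norm] at hX hY ⊢
  intro ε hε
  have h2 := (hX (ε / 2) (by positivity)).add (hY (ε / 2) (by positivity))
  rw [add_zero] at h2
  refine tendsto_of_tendsto_of_tendsto_of_le_of_le tendsto_const_nhds h2
    (fun _ => zero_le) fun n => ?_
  refine (measure_mono fun ω hω => ?_).trans (measure_union_le _ _)
  simp only [Pi.zero_apply, sub_zero, mem_ofPred_eq, mem_union] at hω ⊢
  by_contra hlt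
  push Not at hlt
  exact absurd (hω.trans (norm_add_le _ _)) (by linarith [hlt.1, hlt.2])

theorem tendstoInMeasure_zero_sum {ι : Type*} (s : Finset ι) {X : ι → ℕ → Ω → ℝ}
    (hX : ∀ i ∈ s, TendstoInMeasure P (X i) atTop 0) :
    TendstoInMeasure P (fun n ω => ∑ i ∈ s, X i n ω) atTop 0 := by
  classical
  induction s using Finset.induction_on with
  | empty =>
    simp only [Finset.sum_empty]
    intro ε hε
    simp [hε.ne']
  | insert i s hi ih =>
    simp only [Finset.sum_insert hi]
    exact tendstoInMeasure_zero_add (hX i (by simp)) (ih fun j hj => hX j (by simp [hj]))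

theorem tendstoInMeasure_const_mul_zero [IsFiniteMeasure P] {W : Ω → ℝ} (hW : Measurable W)
    {c : ℕ → ℝ} (hc : Tendsto c atTop (𝓝 0)) :
    TendstoInMeasure P (fun n ω => c n * W ω) atTop 0 := by
  refine tendstoInMeasure_of_tendsto_ae (fun n => (hW.const_mul _).aestronglyMeasurable)
    (ae_of_all _ fun ω => ?_)
  simpa using hc.mul_const (W ω)

end Convergence

/-! ### Laws for iid sums: quadratic deviations and the multivariate central limit theorem -/

section IID

variable {Ω : Type*} [MeasurableSpace Ω] {P : Measure Ω} [IsProbabilityMeasure P]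

/-- Chebyshev's inequality for empirical means, in the form used for quadratic remainders. -/
theorem tendstoInMeasure_sqrt_mul_sq_sub {X : ℕ → Ω → ℝ} (hX : MemLp (X 0) 2 P)
    (hindep : iIndepFun X P) (hident : ∀ i, IdentDistrib (X i) (X 0) P P) {m : ℝ}
    (hm : P[X 0] = m) :
    TendstoInMeasure P (fun (n : ℕ) ω => √n * ((∑ k ∈ Finset.range n, X k ω) / n - m) ^ 2)
      atTop 0 := by
  have hmem : ∀ i, MemLp (X i) 2 P := fun i => (hident i).memLp_iff.2 hX
  have hint : ∀ i, Integrable (X i) P := fun i => (hmem i).integrable (by norm_num)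
  have hvar : ∀ n : ℕ, Var[∑ k ∈ Finset.range n, X k; P] = n * Var[X 0; P] := by
    intro n
    rw [IndepFun.variance_sum (fun i _ => hmem i)
      (fun i _ j _ hij => hindep.indepFun hij)]
    simp [fun i => (hident i).variance_eq]
  have hmean : ∀ n : ℕ, ∫ ω, ∑ k ∈ Finset.range n, X k ω ∂P = n * m := by
    intro n
    rw [integral_finsetSum _ fun i _ => hint i]
    simp [fun i => (hident i).integral_eq, hm]
  rw [tendstoInMeasure_iff_norm]
  intro ε hε
  have hlim : Tendsto (fun n : ℕ => ENNReal.ofReal (Var[X 0; P] / ε * (√n)⁻¹)) atTop (𝓝 0) := by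
    rw [← ENNReal.ofReal_zero]
    refine (ENNReal.continuous_ofReal.tendsto 0).comp ?_
    have : Tendsto (fun n : ℕ => (√(n : ℝ))⁻¹) atTop (𝓝 0) :=
      (tendsto_inv_atTop_zero.comp Real.tendsto_sqrt_atTop).comp tendsto_natCast_atTop_atTop
    simpa using this.const_mul (Var[X 0; P] / ε)
  refine tendsto_of_tendsto_of_tendsto_of_le_of_le' tendsto_const_nhds hlim
    (Eventually.of_forall fun _ => zero_le) ?_
  filter_upwards [eventually_gt_atTop 0] with n hn
  have hn' : (0 : ℝ) < n := Nat.cast_pos.2 hn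
  have hs : 0 < √(n : ℝ) := Real.sqrt_pos.2 hn'
  have hss : √(n : ℝ) ^ 2 = n := Real.sq_sqrt hn'.le
  -- The Chebyshev threshold for the sum itself: `√n * (S/n - m) ^ 2 ≥ ε` means `|S - n m| ≥ √(ε n²
  -- / √n)`, and the resulting bound is `Var / (ε √n)`.
  have hc : 0 < √(ε * n ^ 2 / √n) := Real.sqrt_pos.2 (by positivity)
  have hsum : MemLp (∑ k ∈ Finset.range n, X k) 2 P := memLp_finsetSum' _ fun i _ => hmem i
  refine (measure_mono fun ω hω => ?_).trans
    ((meas_ge_le_variance_div_sq hsum hc).trans (ENNReal.ofReal_le_ofReal (le_of_eq ?_)))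
  · simp only [Pi.zero_apply, sub_zero, mem_ofPred_eq, Real.norm_eq_abs,
      Finset.sum_apply, hmean] at hω ⊢
    rw [abs_of_nonneg (by positivity)] at hω
    refine Real.sqrt_le_iff.2 ⟨abs_nonneg _, ?_⟩
    rw [sq_abs, div_le_iff₀ hs]
    have : (∑ k ∈ Finset.range n, X k ω) - n * m
        = n * ((∑ k ∈ Finset.range n, X k ω) / n - m) := by field_simp
    rw [this, mul_pow]
    nlinarith [mul_le_mul_of_nonneg_left hω (sq_nonneg (n : ℝ))]
  · rw [hvar, Real.sq_sqrt (by positivity)]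
    field_simp
    rw [hss, mul_comm]

/-- The multivariate central limit theorem for centered iid vectors. -/
theorem tendstoInDistribution_inv_sqrt_smul_sum {d : ℕ}
    {X : ℕ → Ω → EuclideanSpace ℝ (Fin d)} {S : Matrix (Fin d) (Fin d) ℝ}
    (hX : ∀ i, MemLp (fun ω => X 0 ω i) 2 P) (hindep : iIndepFun X P)
    (hident : ∀ i, IdentDistrib (X i) (X 0) P P) (h0 : ∀ i, ∫ ω, X 0 ω i ∂P = 0)
    (hS : ∀ i j, ∫ ω, X 0 ω i * X 0 ω j ∂P = S i j) :
    S.PosSemidef ∧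
    TendstoInDistribution (fun (n : ℕ) ω => (√n)⁻¹ • ∑ k ∈ Finset.range n, X k ω) atTop id
      (fun _ => P) (multivariateGaussian 0 S) := by
  have hinner : ∀ (t x : EuclideanSpace ℝ (Fin d)), inner ℝ x t = ∑ i, t i * x i := by
    intro t x
    simp [PiLp.inner_apply]
  have hLp : ∀ t, MemLp (fun ω => inner ℝ (X 0 ω) t) 2 P := by
    intro t
    simp_rw [hinner]
    exact memLp_finsetSum _ fun i _ => (hX i).const_mul _
  have hquad : ∀ t : EuclideanSpace ℝ (Fin d),
      ∫ ω, (inner ℝ (X 0 ω) t) ^ 2 ∂P = t.ofLp ⬝ᵥ S.mulVec t.ofLp := by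
    intro t
    have hint : ∀ i j, Integrable (fun ω => t i * X 0 ω i * (t j * X 0 ω j)) P := fun i j =>
      ((hX i).const_mul (t i)).integrable_mul ((hX j).const_mul (t j))
    simp_rw [hinner, pow_two, Finset.sum_mul_sum]
    rw [integral_finsetSum _ fun i _ => integrable_finsetSum _ fun j _ => hint i j]
    simp_rw [dotProduct, Matrix.mulVec, dotProduct, Finset.mul_sum]
    refine Finset.sum_congr rfl fun i _ => ?_
    rw [integral_finsetSum _ fun j _ => hint i j]
    refine Finset.sum_congr rfl fun j _ => ?_
    rw [← hS i j, ← integral_mul_const, ← integral_const_mul]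
    congr 1
    ext ω
    ring
  -- The quadratic form of `S` at `t` is the second moment of `⟪X 0, t⟫`.
  have hpsd : S.PosSemidef := by
    refine Matrix.PosSemidef.of_dotProduct_mulVec_nonneg ?_ fun x => ?_
    · ext i j
      simp only [Matrix.conjTranspose_apply, star_trivial, ← hS]
      congr 1
      ext ω
      ring
    · have := hquad (WithLp.toLp 2 x)
      simp only [star_trivial]
      rw [show x = (WithLp.toLp 2 x).ofLp from rfl, ← this]
      positivity
  refine ⟨hpsd, ?_⟩
  have hmeas : ∀ i, AEMeasurable (X i) P := fun i => (hident i).aemeasurable_fst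
  have hmeasS : ∀ n : ℕ, AEMeasurable (fun ω => (√(n : ℝ))⁻¹ • ∑ k ∈ Finset.range n, X k ω) P :=
    fun n => (Finset.aemeasurable_fun_sum _ fun i _ => hmeas i).const_smul (√(n : ℝ))⁻¹
  refine ⟨hmeasS, by fun_prop, ?_⟩
  -- Cramér–Wold: the characteristic function at `t` is that of the projection on `t`, evaluated at
  -- 1, so the scalar central limit theorem suffices.
  refine ProbabilityMeasure.tendsto_iff_tendsto_charFun.2 fun t => ?_
  have hm : Measurable fun x : EuclideanSpace ℝ (Fin d) => inner ℝ x t := by fun_prop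
  have hclt := tendstoInDistribution_inv_sqrt_mul_sum_sub (P := P)
    (P' := gaussianReal 0 Var[fun ω => inner ℝ (X 0 ω) t; P].toNNReal) (Y := id)
    (X := fun k ω => inner ℝ (X k ω) t) ⟨aemeasurable_id, Measure.map_id⟩ (hLp t)
    (hindep.comp (fun _ x => inner ℝ x t) fun _ => hm)
    (fun i => (hident i).comp hm)
  have hmean : ∫ ω, inner ℝ (X 0 ω) t ∂P = 0 := by
    simp_rw [hinner]
    rw [integral_finsetSum _ fun i _ => ((hX i).integrable (by norm_num)).const_mul _]
    simp [integral_const_mul, h0]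
  have hvar : Var[fun ω => inner ℝ (X 0 ω) t; P] = t.ofLp ⬝ᵥ S.mulVec t.ofLp := by
    rw [variance_of_integral_eq_zero (hLp t).aestronglyMeasurable.aemeasurable hmean, hquad]
  have hnn : 0 ≤ t.ofLp ⬝ᵥ S.mulVec t.ofLp := by
    rw [← hquad]
    positivity
  have hlim := ProbabilityMeasure.tendsto_iff_tendsto_charFun.1 hclt.tendsto 1
  simp only [ProbabilityMeasure.coe_mk, hvar, Measure.map_id] at hlim ⊢
  rw [charFun_gaussianReal] at hlim
  rw [charFun_multivariateGaussian hpsd]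
  convert hlim using 1
  · ext n
    rw [charFun_apply, charFun_apply, integral_map (hmeasS n) (by fun_prop), integral_map]
    · congr 1
      ext ω
      simp [hmean, inner_smul_left, sum_inner]
    · refine AEMeasurable.const_mul (AEMeasurable.sub_const ?_ _) _
      exact Finset.aemeasurable_fun_sum _ fun i _ => hm.comp_aemeasurable (hmeas i)
    · fun_prop
  · congr 2
    simp [Real.coe_toNNReal _ hnn]

end IID

/-! ### Quantitative first-order expansions and the delta method -/

section Delta

theorem exists_abs_one_add_rpow_sub_le (b : ℝ) :
    ∃ C > 0, ∃ ρ > 0, ∀ u : ℝ, |u| ≤ ρ → |(1 + u) ^ b - 1| ≤ C * |u| := by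
  have hd : HasDerivAt (fun u : ℝ => (1 + u) ^ b) (1 * b * (1 + 0) ^ (b - 1)) 0 :=
    ((hasDerivAt_id (0 : ℝ)).const_add 1).rpow_const (Or.inl (by norm_num))
  obtain ⟨C, hC, hO⟩ := hd.isBigO_sub.exists_pos
  obtain ⟨ρ, hρ, hb⟩ := Metric.eventually_nhds_iff.1 hO.bound
  refine ⟨C, hC, ρ / 2, by positivity, fun u hu => ?_⟩
  have := hb (y := u) (by rw [Real.dist_eq, sub_zero]; linarith)
  simpa using this

theorem exists_abs_one_add_rpow_sub_linear_le (b : ℝ) :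
    ∃ C > 0, ∃ ρ > 0, ∀ u : ℝ, |u| ≤ ρ → |(1 + u) ^ b - 1 - b * u| ≤ C * u ^ 2 := by
  obtain ⟨C, hC, ρ, hρ, h⟩ := exists_abs_one_add_rpow_sub_le (b - 1)
  -- Mean value inequality on the ball of radius `|u|`, where the derivative of the remainder is at
  -- most `|b| C |u|`. The `+ 1` keeps the constant positive for `b = 0`, and radius `1 / 2` keeps
  -- `1 + x` away from 0.
  refine ⟨(|b| + 1) * C, by positivity, min ρ (1 / 2), by positivity, fun u hu => ?_⟩
  have hder : ∀ x ∈ Metric.closedBall (0 : ℝ) |u|,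
      HasDerivWithinAt (fun x : ℝ => (1 + x) ^ b - 1 - b * x)
        (1 * b * (1 + x) ^ (b - 1) - b * 1) (Metric.closedBall (0 : ℝ) |u|) x := by
    intro x hx
    rw [mem_closedBall_zero_iff, Real.norm_eq_abs] at hx
    have hx1 : (1 : ℝ) + x ≠ 0 := by
      have := (abs_le.1 (hx.trans (hu.trans (min_le_right _ _)))).1
      linarith
    exact (((((hasDerivAt_id x).const_add 1).rpow_const (Or.inl hx1)).sub_const 1).sub
      ((hasDerivAt_id x).const_mul b)).hasDerivWithinAt
  have hbound : ∀ x ∈ Metric.closedBall (0 : ℝ) |u|,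
      ‖1 * b * (1 + x) ^ (b - 1) - b * 1‖ ≤ (|b| + 1) * C * |u| := by
    intro x hx
    rw [mem_closedBall_zero_iff, Real.norm_eq_abs] at hx
    have := h x (hx.trans (hu.trans (min_le_left _ _)))
    rw [show 1 * b * (1 + x) ^ (b - 1) - b * 1 = b * ((1 + x) ^ (b - 1) - 1) by ring,
      Real.norm_eq_abs, abs_mul, mul_assoc]
    exact mul_le_mul (by linarith) (this.trans (by gcongr)) (abs_nonneg _) (by positivity)
  have := (convex_closedBall (0 : ℝ) |u|).norm_image_sub_le_of_norm_hasDerivWithin_le hder hbound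
    (show (0 : ℝ) ∈ Metric.closedBall (0 : ℝ) |u| by simp)
    (show u ∈ Metric.closedBall (0 : ℝ) |u| by simp)
  simp only [add_zero, Real.one_rpow, sub_self, mul_zero, sub_zero, Real.norm_eq_abs] at this
  rwa [mul_assoc, ← pow_two, sq_abs] at this

theorem exists_abs_rpow_mul_rpow_sub_linear_le (b a : ℝ) :
    ∃ C > 0, ∃ ρ > 0, ∀ u v : ℝ, |u| ≤ ρ → |v| ≤ ρ →
      |(1 + u) ^ b * (1 + v) ^ a - 1 - (b * u + a * v)| ≤ C * (u ^ 2 + v ^ 2) := by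
  obtain ⟨C, hC, ρ, hρ, h⟩ := exists_abs_one_add_rpow_sub_linear_le b
  obtain ⟨D, hD, σ, hσ, k⟩ := exists_abs_one_add_rpow_sub_linear_le a
  refine ⟨C * (1 + |a| + D) + D * (1 + |b|) + |a| * |b|, by positivity, min (min ρ σ) 1,
    by positivity, fun u v hu hv => ?_⟩
  have hu' := h u (hu.trans ((min_le_left _ _).trans (min_le_left _ _)))
  have hv' := k v (hv.trans ((min_le_left _ _).trans (min_le_right _ _)))
  have hu1 : |u| ≤ 1 := hu.trans (min_le_right _ _)
  have hv1 : |v| ≤ 1 := hv.trans (min_le_right _ _)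
  set r := (1 + u) ^ b - 1 - b * u with hr
  set s := (1 + v) ^ a - 1 - a * v with hs
  have hv2 : v ^ 2 ≤ 1 := by rw [← sq_abs]; nlinarith [abs_nonneg v]
  have huv : |u * v| ≤ u ^ 2 + v ^ 2 := by
    rw [abs_mul, ← sq_abs u, ← sq_abs v]
    nlinarith [sq_nonneg (|u| - |v|), abs_nonneg u, abs_nonneg v]
  have e : (1 + u) ^ b * (1 + v) ^ a - 1 - (b * u + a * v)
      = r * (1 + a * v + s) + s * (1 + b * u) + a * b * (u * v) := by
    rw [hr, hs]
    ring
  have h1 : |r * (1 + a * v + s)| ≤ C * u ^ 2 * (1 + |a| + D) := by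
    rw [abs_mul]
    refine mul_le_mul hu' ?_ (abs_nonneg _) (by positivity)
    refine (abs_add_le _ _).trans (add_le_add ((abs_add_le _ _).trans ?_) (hv'.trans ?_))
    · rw [abs_one, abs_mul]
      nlinarith [abs_nonneg a]
    · nlinarith
  have h2 : |s * (1 + b * u)| ≤ D * v ^ 2 * (1 + |b|) := by
    rw [abs_mul]
    refine mul_le_mul hv' ((abs_add_le _ _).trans ?_) (abs_nonneg _) (by positivity)
    rw [abs_one, abs_mul]
    nlinarith [abs_nonneg b]
  have h3 : |a * b * (u * v)| ≤ |a| * |b| * (u ^ 2 + v ^ 2) := by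
    rw [abs_mul, abs_mul]
    exact mul_le_mul_of_nonneg_left huv (by positivity)
  rw [e]
  refine (abs_add_le _ _).trans (le_trans (add_le_add ((abs_add_le _ _).trans
    (add_le_add h1 h2)) h3) ?_)
  have : 0 ≤ C * (1 + |a| + D) * v ^ 2 + D * (1 + |b|) * u ^ 2 := by positivity
  nlinarith

/-- Deterministic core of the delta method: one small quantity `x` dominating the rescaled squares
and the radial perturbation controls the whole linearisation error, uniformly in `n ≥ 1`. -/
theorem abs_sqrt_mul_rpow_mul_rpow_sub_le (b a : ℝ) :
    ∃ C > 0, ∃ ρ > 0, ∀ n : ℝ, 1 ≤ n → ∀ x u v w : ℝ, x ≤ ρ → √n * u ^ 2 ≤ x → √n * v ^ 2 ≤ x →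
      |w| / √n ≤ x →
      |√n * ((1 + u) ^ b * (1 + v + w / n) ^ a - 1) - √n * (b * u + a * v)| ≤ C * x := by
  obtain ⟨C, hC, ρ, hρ, h⟩ := exists_abs_rpow_mul_rpow_sub_linear_le b a
  -- The quadratic error is `C (x + 4x)`, from `u` and from `v + w/n`; the linear effect of `w/n`
  -- costs `|a| x`. The bounds on `x` give `|u| ≤ ρ`, `|v| ≤ ρ/2`, `|w/n| ≤ ρ/2`, and `x ≤ 1`
  -- absorbs the square of `w/n`.
  refine ⟨C * 5 + |a|, by positivity, min 1 (min (ρ ^ 2) (min ((ρ / 2) ^ 2) (ρ / 2))),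
    by positivity, fun n hn x u v w hx hu hv hw => ?_⟩
  have hn0 : 0 < n := by linarith
  have hs1 : 1 ≤ √n := Real.one_le_sqrt.2 hn
  have hs0 : 0 < √n := by linarith
  have hss : √n * √n = n := Real.mul_self_sqrt hn0.le
  simp only [le_min_iff] at hx
  obtain ⟨hx1, hx2, hx3, hx4⟩ := hx
  have hx0 : 0 ≤ x := le_trans (by positivity) hw
  have hu2 : u ^ 2 ≤ x := le_trans (by nlinarith [sq_nonneg u]) hu
  have hv2 : v ^ 2 ≤ x := le_trans (by nlinarith [sq_nonneg v]) hv
  have hwn : |w / n| * √n ≤ x := by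
    rw [abs_div, abs_of_pos hn0]
    refine le_trans (le_of_eq ?_) hw
    rw [div_mul_eq_mul_div, div_eq_div_iff hn0.ne' hs0.ne', mul_assoc, hss]
  have hwn1 : |w / n| ≤ x := le_trans (by nlinarith [abs_nonneg (w / n)]) hwn
  have huρ : |u| ≤ ρ := abs_le_of_sq_le_sq (hu2.trans hx2) hρ.le
  have hvρ : |v| ≤ ρ / 2 := abs_le_of_sq_le_sq (hv2.trans hx3) (by positivity)
  have hvw : |v + w / n| ≤ ρ := (abs_add_le _ _).trans (by linarith)
  have key := h u (v + w / n) huρ hvw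
  rw [← add_assoc] at key
  have hq : √n * (v + w / n) ^ 2 ≤ 4 * x := by
    have h1 : (v + w / n) ^ 2 ≤ 2 * v ^ 2 + 2 * |w / n| ^ 2 := by
      rw [sq_abs]
      nlinarith [sq_nonneg (v - w / n)]
    have h2 : √n * |w / n| ^ 2 ≤ x := by
      nlinarith [abs_nonneg (w / n)]
    nlinarith
  have e : √n * ((1 + u) ^ b * (1 + v + w / n) ^ a - 1) - √n * (b * u + a * v)
      = √n * ((1 + u) ^ b * (1 + v + w / n) ^ a - 1 - (b * u + a * (v + w / n)))
        + a * (w / n * √n) := by ring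
  rw [e]
  refine (abs_add_le _ _).trans ?_
  have h3 : |a * (w / n * √n)| ≤ |a| * x := by
    rw [abs_mul, abs_mul, abs_of_pos hs0]
    exact mul_le_mul_of_nonneg_left hwn (abs_nonneg _)
  have h4 : |√n * ((1 + u) ^ b * (1 + v + w / n) ^ a - 1 - (b * u + a * (v + w / n)))|
      ≤ C * 5 * x := by
    rw [abs_mul, abs_of_pos hs0]
    refine (mul_le_mul_of_nonneg_left key hs0.le).trans ?_
    nlinarith
  linarith

variable {Ω : Type*} [MeasurableSpace Ω] {P : Measure Ω} [IsProbabilityMeasure P]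

/-- Delta method at the point where all means equal 1: the gradient there is `(b i, a)`, so the
limit is that of the iid sums of `φ (Y k)`, the difference tending to 0 in probability. -/
theorem tendstoInDistribution_sqrt_mul_rpow_mul_rpow {d : ℕ} {Y : ℕ → Ω → ℝ} {W : Ω → ℝ}
    {g : Fin d → ℝ → ℝ} {h : ℝ → ℝ} {b : Fin d → ℝ} {a : ℝ} {S : Matrix (Fin d) (Fin d) ℝ}
    (hYm : ∀ k, Measurable (Y k)) (hW : Measurable W)
    (hindep : iIndepFun Y P) (hident : ∀ i, IdentDistrib (Y i) (Y 0) P P)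
    (hg : ∀ i, Measurable (g i)) (hh : Measurable h)
    (hg2 : ∀ i, MemLp (fun ω => g i (Y 0 ω)) 2 P) (hh2 : MemLp (fun ω => h (Y 0 ω)) 2 P)
    (hg1 : ∀ i, ∫ ω, g i (Y 0 ω) ∂P = 1) (hh1 : ∫ ω, h (Y 0 ω) ∂P = 1)
    (hS : ∀ i j, ∫ ω, (b i * (g i (Y 0 ω) - 1) + a * (h (Y 0 ω) - 1)) *
      (b j * (g j (Y 0 ω) - 1) + a * (h (Y 0 ω) - 1)) ∂P = S i j) :
    S.PosSemidef ∧
    TendstoInDistribution (fun (n : ℕ) ω => (WithLp.toLp 2 fun i =>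
      √n * (((∑ k ∈ Finset.range n, g i (Y k ω)) / n) ^ b i *
        ((∑ k ∈ Finset.range n, h (Y k ω)) / n + W ω / n) ^ a - 1) : EuclideanSpace ℝ (Fin d)))
      atTop id (fun _ => P) (multivariateGaussian 0 S) := by
  set φ : ℝ → EuclideanSpace ℝ (Fin d) := fun y => WithLp.toLp 2 fun i =>
    b i * (g i y - 1) + a * (h y - 1) with hφ
  have hφm : Measurable φ := by
    refine (PiLp.continuous_toLp 2 _).measurable.comp (measurable_pi_lambda _ fun i => ?_)
    have := hg i
    fun_prop
  obtain ⟨hpsd, hclt⟩ := tendstoInDistribution_inv_sqrt_smul_sum (P := P)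
    (X := fun k ω => φ (Y k ω)) (S := S)
    (fun i => (((hg2 i).sub (memLp_const 1)).const_mul (b i)).add
      ((hh2.sub (memLp_const 1)).const_mul a))
    (hindep.comp (fun _ => φ) fun _ => hφm) (fun i => (hident i).comp hφm)
    (fun i => by
      have hi : Integrable (fun ω => g i (Y 0 ω)) P := (hg2 i).integrable (by norm_num)
      have hi' : Integrable (fun ω => h (Y 0 ω)) P := hh2.integrable (by norm_num)
      have hi1 : Integrable (fun ω => b i * (g i (Y 0 ω) - 1)) P :=
        (hi.sub (integrable_const 1)).const_mul _
      have hi2 : Integrable (fun ω => a * (h (Y 0 ω) - 1)) P :=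
        (hi'.sub (integrable_const 1)).const_mul _
      simp only [hφ]
      rw [integral_add hi1 hi2, integral_const_mul, integral_const_mul,
        integral_sub hi (integrable_const _), integral_sub hi' (integrable_const _), hg1, hh1]
      simp)
    (by simpa [hφ] using hS)
  refine ⟨hpsd, tendstoInDistribution_of_tendstoInMeasure_sub _ _ hclt ?_ fun n => ?_⟩
  · have hXg : ∀ i, TendstoInMeasure P (fun (n : ℕ) ω =>
        √n * ((∑ k ∈ Finset.range n, g i (Y k ω)) / n - 1) ^ 2) atTop 0 := fun i =>
      tendstoInMeasure_sqrt_mul_sq_sub (X := fun k ω => g i (Y k ω)) (hg2 i)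
        (hindep.comp (fun _ => g i) fun _ => hg i) (fun k => (hident k).comp (hg i)) (hg1 i)
    have hXh : TendstoInMeasure P (fun (n : ℕ) ω =>
        √n * ((∑ k ∈ Finset.range n, h (Y k ω)) / n - 1) ^ 2) atTop 0 :=
      tendstoInMeasure_sqrt_mul_sq_sub (X := fun k ω => h (Y k ω)) hh2
        (hindep.comp (fun _ => h) fun _ => hh) (fun k => (hident k).comp hh) hh1
    have hXW : TendstoInMeasure P (fun (n : ℕ) ω => (√(n : ℝ))⁻¹ * |W ω|) atTop 0 :=
      tendstoInMeasure_const_mul_zero hW.abs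
        ((tendsto_inv_atTop_zero.comp Real.tendsto_sqrt_atTop).comp tendsto_natCast_atTop_atTop)
    refine tendstoInMeasure_zero_of_small
      (tendstoInMeasure_zero_add (tendstoInMeasure_zero_add
        (tendstoInMeasure_zero_sum Finset.univ fun i _ => hXg i) hXh) hXW) fun ε hε => ?_
    choose C hC ρ hρ key using fun i => abs_sqrt_mul_rpow_mul_rpow_sub_le (b i) a
    have hCs : 0 ≤ ∑ i, C i := Finset.sum_nonneg fun i _ => (hC i).le
    -- The element 1 is inserted so that the minimum makes sense for `d = 0` too.
    obtain ⟨δ, hδ, hδρ⟩ : ∃ δ > 0, ∀ i, δ ≤ ρ i := by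
      have hne : (insert 1 (Finset.univ.image ρ)).Nonempty := Finset.insert_nonempty _ _
      refine ⟨(insert 1 (Finset.univ.image ρ)).min' hne, ?_, fun i => Finset.min'_le _ _ (by simp)⟩
      rw [gt_iff_lt, Finset.lt_min'_iff]
      simp only [Finset.mem_insert, Finset.mem_image, Finset.mem_univ, true_and]
      rintro y (rfl | ⟨i, rfl⟩)
      exacts [one_pos, hρ i]
    refine ⟨min δ (ε / (∑ i, C i + 1)), by positivity, ?_⟩
    filter_upwards [eventually_ge_atTop 1] with n hn ω hω
    have hn1 : (1 : ℝ) ≤ n := by exact_mod_cast hn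
    have hs0 : 0 < √(n : ℝ) := by positivity
    have hss : √(n : ℝ) * √n = n := Real.mul_self_sqrt (by positivity)
    set u : Fin d → ℝ := fun i => (∑ k ∈ Finset.range n, g i (Y k ω)) / n - 1 with hu
    set v : ℝ := (∑ k ∈ Finset.range n, h (Y k ω)) / n - 1 with hv
    set x : ℝ := ∑ i, √(n : ℝ) * u i ^ 2 + √n * v ^ 2 + (√n)⁻¹ * |W ω| with hx
    have hux : 0 ≤ ∑ i, √(n : ℝ) * u i ^ 2 := by positivity
    have hvx : 0 ≤ √(n : ℝ) * v ^ 2 := by positivity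
    have hwx : 0 ≤ (√(n : ℝ))⁻¹ * |W ω| := by positivity
    have hui : ∀ i, √(n : ℝ) * u i ^ 2 ≤ x := fun i =>
      (Finset.single_le_sum (f := fun i => √(n : ℝ) * u i ^ 2)
        (fun i _ => by positivity) (Finset.mem_univ i)).trans (by linarith)
    have hx0 : 0 ≤ x := by positivity
    rw [abs_of_nonneg hx0, lt_min_iff] at hω
    have hcoord : ∀ i, |√(n : ℝ) * (((∑ k ∈ Finset.range n, g i (Y k ω)) / n) ^ b i *
        ((∑ k ∈ Finset.range n, h (Y k ω)) / n + W ω / n) ^ a - 1)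
          - (√(n : ℝ))⁻¹ * ∑ k ∈ Finset.range n, (b i * (g i (Y k ω) - 1) + a * (h (Y k ω) - 1))|
        ≤ C i * x := by
      intro i
      have := key i n hn1 x (u i) v (W ω) (hω.1.le.trans (hδρ i)) (hui i) (by linarith)
        (by rw [div_eq_inv_mul]; linarith)
      convert this using 2
      congr 1
      · rw [hu, hv]
        ring_nf
      · rw [Finset.sum_add_distrib, ← Finset.mul_sum, ← Finset.mul_sum, Finset.sum_sub_distrib,
          Finset.sum_sub_distrib]
        simp only [Finset.sum_const, Finset.card_range, nsmul_eq_mul, mul_one, hu, hv]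
        rw [inv_mul_eq_div, div_eq_iff hs0.ne', mul_comm (√(n : ℝ)), mul_assoc, hss]
        field_simp
    refine lt_of_le_of_lt (b := ∑ i, C i * x) ?_ ?_
    · rw [EuclideanSpace.norm_eq]
      refine Real.sqrt_le_iff.2 ⟨Finset.sum_nonneg fun i _ => mul_nonneg (hC i).le hx0, ?_⟩
      -- The Euclidean norm is at most the sum of the coordinate errors.
      refine le_trans ?_ (Finset.sum_sq_le_sq_sum_of_nonneg
        fun i _ => mul_nonneg (hC i).le hx0)
      refine Finset.sum_le_sum fun i _ => pow_le_pow_left₀ (norm_nonneg _) ?_ 2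
      simpa [hφ] using hcoord i
    · rw [← Finset.sum_mul]
      have := (lt_div_iff₀ (by positivity)).1 hω.2
      nlinarith
  · refine Measurable.aemeasurable ((PiLp.continuous_toLp 2 _).measurable.comp
      (measurable_pi_lambda _ fun i => ?_))
    have := hg i
    fun_prop

end Delta

/-! ### The `p`-generalized Gaussian law: moments and tail -/

section PGaussian

noncomputable section

/-- The density of the `p`-generalized Gaussian distribution. -/
def pGaussianPDF (p x : ℝ) : ℝ := K p / 2 * Real.exp (-(1 / p) * |x| ^ p)

/-- The `p`-generalized Gaussian distribution, with density proportional to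
`x ↦ exp (-|x| ^ p / p)`. -/
def pGaussian (p : ℝ) : Measure ℝ := volume.withDensity fun x => ENNReal.ofReal (pGaussianPDF p x)

end

variable {p : ℝ}

theorem K_pos (hp : 0 < p) : 0 < K p := by
  have := Real.Gamma_pos_of_pos (s := 1 + 1 / p) (by positivity)
  unfold K
  positivity

theorem pGaussianPDF_pos (hp : 0 < p) (x : ℝ) : 0 < pGaussianPDF p x := by
  have := K_pos hp
  unfold pGaussianPDF
  positivity

theorem measurable_pGaussianPDF : Measurable (pGaussianPDF p) := by
  unfold pGaussianPDF
  fun_prop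

theorem integral_pGaussian (hp : 0 < p) (f : ℝ → ℝ) :
    ∫ x, f x ∂pGaussian p = ∫ x, pGaussianPDF p x * f x := by
  rw [pGaussian, integral_withDensity_eq_integral_toReal_smul (by
    have := measurable_pGaussianPDF (p := p)
    fun_prop) (by simp)]
  simp [ENNReal.toReal_ofReal (pGaussianPDF_pos hp _).le]

theorem integral_comp_abs_pGaussian (hp : 0 < p) (f : ℝ → ℝ) :
    ∫ x, f |x| ∂pGaussian p = K p * ∫ x in Ioi 0, f x * Real.exp (-(1 / p) * x ^ p) := by
  rw [integral_pGaussian hp]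
  have h := integral_comp_abs (f := fun x => K p / 2 * (f x * Real.exp (-(1 / p) * x ^ p)))
  nth_rw 2 [integral_const_mul] at h
  rw [← mul_assoc] at h
  rw [show K p = 2 * (K p / 2) by ring, ← h]
  congr 1
  ext x
  unfold pGaussianPDF
  ring

theorem integral_abs_rpow_pGaussian (hp : 0 < p) {r : ℝ} (hr : 0 ≤ r) :
    ∫ x, |x| ^ r ∂pGaussian p = p ^ (r / p) / (r + 1) *
      (Real.Gamma (1 + (r + 1) / p) / Real.Gamma (1 + 1 / p)) := by
  rw [integral_comp_abs_pGaussian hp (fun x => x ^ r),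
    integral_rpow_mul_exp_neg_mul_rpow hp (by linarith) (by positivity)]
  have h1 : Real.Gamma (1 + (r + 1) / p) = (r + 1) / p * Real.Gamma ((r + 1) / p) := by
    rw [add_comm, Real.Gamma_add_one (by positivity)]
  have h2 : (1 / p) ^ (-(r + 1) / p) = p ^ (r / p) * p ^ (1 / p) := by
    rw [one_div, Real.inv_rpow hp.le, ← Real.rpow_neg hp.le, ← Real.rpow_add hp]
    congr 1
    ring
  have h3 := Real.Gamma_pos_of_pos (s := 1 + 1 / p) (by positivity)
  have h4 : (0 : ℝ) < p ^ (1 / p) := by positivity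
  rw [h1, h2, K]
  field_simp

theorem isProbabilityMeasure_pGaussian (hp : 0 < p) : IsProbabilityMeasure (pGaussian p) := by
  -- The total mass is the moment of order 0.
  have h := integral_abs_rpow_pGaussian hp le_rfl
  have h3 := Real.Gamma_pos_of_pos (s := 1 + 1 / p) (by positivity)
  simp only [Real.rpow_zero, integral_const, smul_eq_mul, mul_one, zero_div, zero_add,
    div_self h3.ne', div_one] at h
  refine ⟨?_⟩
  rwa [measureReal_def, ENNReal.toReal_eq_one_iff] at h

theorem M_eq_integral_pGaussian {p r : ℝ≥0∞} (hp : 1 ≤ p) (hp' : p ≠ ∞) :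
    M p r = ∫ x, |x| ^ r.toReal ∂pGaussian p.toReal := by
  rw [integral_abs_rpow_pGaussian (ENNReal.toReal_pos (by positivity) hp')
    ENNReal.toReal_nonneg, M, if_neg hp']

theorem integrableOn_exp_neg_mul_rpow (hp : 0 < p) :
    IntegrableOn (fun x : ℝ => Real.exp (-(1 / p) * x ^ p)) (Ioi 0) := by
  have := integrableOn_rpow_mul_exp_neg_mul_rpow (s := 0) (b := 1 / p) (by norm_num) hp
    (by positivity)
  simpa using this

theorem pGaussian_real_abs_gt (hp : 0 < p) {t : ℝ} (ht : 0 ≤ t) :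
    (pGaussian p).real {x | t < |x|} = K p * ∫ x in Ioi t, Real.exp (-(1 / p) * x ^ p) := by
  have h := integral_comp_abs_pGaussian hp ((Ioi t).indicator fun _ => 1)
  have h1 : (fun x : ℝ => (Ioi t).indicator (fun _ => (1 : ℝ)) |x|)
      = {x | t < |x|}.indicator fun _ => 1 := by
    ext x
    simp [indicator]
  have hm : MeasurableSet {x : ℝ | t < |x|} := measurableSet_lt (by fun_prop) (by fun_prop)
  rw [h1, integral_indicator hm] at h
  have h2 : (fun x : ℝ => (Ioi t).indicator (fun _ => (1 : ℝ)) x * Real.exp (-(1 / p) * x ^ p))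
      = (Ioi t).indicator fun x => Real.exp (-(1 / p) * x ^ p) := by
    ext x
    by_cases hx : x ∈ Ioi t <;> simp [hx]
  rw [h2, integral_indicator measurableSet_Ioi, Measure.restrict_restrict measurableSet_Ioi,
    inter_eq_left.2 (Ioi_subset_Ioi ht)] at h
  simpa using h

/-- The Mills ratio of the `p`-generalized Gaussian distribution. -/
theorem tendsto_integral_Ioi_div (hp : 0 < p) :
    Tendsto (fun t : ℝ => (∫ x in Ioi t, Real.exp (-(1 / p) * x ^ p)) /
      (t ^ (1 - p) * Real.exp (-(1 / p) * t ^ p))) atTop (𝓝 1) := by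
  -- The absolute value makes the integrand continuous on all of `ℝ`, as wanted for the fundamental
  -- theorem of calculus; it disappears for positive arguments.
  have hcont : Continuous fun x : ℝ => Real.exp (-(1 / p) * |x| ^ p) := by
    have : Continuous fun x : ℝ => |x| ^ p := continuous_abs.rpow_const fun _ => Or.inr hp.le
    fun_prop
  have hf : ∀ t : ℝ, 0 < t → HasDerivAt (fun t => ∫ x in Ioi t, Real.exp (-(1 / p) * x ^ p))
      (-Real.exp (-(1 / p) * t ^ p)) t := by
    intro t ht
    have h1 : HasDerivAt (fun t => (∫ x in Ioi 0, Real.exp (-(1 / p) * x ^ p))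
        - ∫ x in (0)..t, Real.exp (-(1 / p) * |x| ^ p)) (-Real.exp (-(1 / p) * |t| ^ p)) t :=
      (hcont.integral_hasStrictDerivAt 0 t).hasDerivAt.const_sub _
    rw [abs_of_pos ht] at h1
    refine h1.congr_of_eventuallyEq ?_
    filter_upwards [eventually_gt_nhds ht] with s hs
    have h2 : ∫ x in (0)..s, Real.exp (-(1 / p) * |x| ^ p)
        = ∫ x in (0)..s, Real.exp (-(1 / p) * x ^ p) := by
      refine intervalIntegral.integral_congr fun x hx => ?_
      rw [uIcc_of_le hs.le] at hx
      simp only [abs_of_nonneg hx.1]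
    rw [h2, ← intervalIntegral.integral_Ioi_sub_Ioi (integrableOn_exp_neg_mul_rpow hp) hs.le,
      sub_sub_cancel]
  have hd : Tendsto (fun t : ℝ => -Real.exp (-(1 / p) * t ^ p) /
      ((1 - p) * t ^ (1 - p - 1) * Real.exp (-(1 / p) * t ^ p)
        + t ^ (1 - p) * (Real.exp (-(1 / p) * t ^ p) * (-(1 / p) * (p * t ^ (p - 1))))))
      atTop (𝓝 1) := by
    have h1 : Tendsto (fun t : ℝ => 1 / (1 - (1 - p) * t ^ (-p))) atTop
        (𝓝 (1 / (1 - (1 - p) * 0))) :=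
      tendsto_const_nhds.div (((tendsto_rpow_neg_atTop hp).const_mul _).const_sub _) (by simp)
    simp only [mul_zero, sub_zero, div_one] at h1
    refine h1.congr' ?_
    filter_upwards [eventually_gt_atTop 0] with t ht
    have e1 : t ^ (1 - p) * t ^ (p - 1) = 1 := by
      rw [← Real.rpow_add ht]
      simp
    have he := (Real.exp_pos (-(1 / p) * t ^ p)).ne'
    rw [show 1 - p - 1 = -p by ring]
    have e2 : (1 - p) * t ^ (-p) * Real.exp (-(1 / p) * t ^ p)
        + t ^ (1 - p) * (Real.exp (-(1 / p) * t ^ p) * (-(1 / p) * (p * t ^ (p - 1))))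
        = -Real.exp (-(1 / p) * t ^ p) * (1 - (1 - p) * t ^ (-p)) := by
      have : t ^ (1 - p) * (Real.exp (-(1 / p) * t ^ p) * (-(1 / p) * (p * t ^ (p - 1))))
          = -(p / p) * Real.exp (-(1 / p) * t ^ p) * (t ^ (1 - p) * t ^ (p - 1)) := by ring
      rw [this, e1, div_self hp.ne']
      ring
    rw [e2, ← div_div, div_self (neg_ne_zero.2 he)]
  refine HasDerivAt.lhopital_zero_atTop ?_ ?_ ?_ ?_ ?_ hd
  · filter_upwards [eventually_gt_atTop 0] with t ht using hf t ht
  · filter_upwards [eventually_gt_atTop 0] with t ht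
    exact ((Real.hasDerivAt_rpow_const (Or.inl ht.ne'))).mul
      (((Real.hasDerivAt_rpow_const (Or.inl ht.ne')).const_mul (-(1 / p))).exp)
  -- The derivative of the denominator is eventually nonzero: otherwise the quotient would be 0 by
  -- the convention for division, although it tends to 1.
  · filter_upwards [hd.eventually_ne one_ne_zero] with t ht h0
    rw [h0, div_zero] at ht
    exact ht rfl
  · exact tendsto_integral_Ioi_zero tendsto_id
  · refine ((tendsto_rpow_mul_exp_neg_mul_atTop_nhds_zero ((1 - p) / p) (1 / p)
      (by positivity)).comp (tendsto_rpow_atTop hp)).congr' ?_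
    filter_upwards [eventually_gt_atTop 0] with t ht
    simp only [Function.comp_apply]
    rw [← Real.rpow_mul ht.le, mul_div_cancel₀ _ hp.ne']

end PGaussian

/-! ### Probabilistic representation of the uniform law on the ball for `p < ∞` -/

section Representation

theorem continuous_lpNorm {n : ℕ} (p : ℝ≥0∞) [Fact (1 ≤ p)] :
    Continuous (lpNorm p : (Fin n → ℝ) → ℝ) :=
  continuous_norm.comp (PiLp.continuous_toLp p _)

theorem measurable_lpNorm {n : ℕ} {p : ℝ≥0∞} (hp : 1 ≤ p) :
    Measurable (lpNorm p : (Fin n → ℝ) → ℝ) :=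
  have : Fact (1 ≤ p) := ⟨hp⟩
  (continuous_lpNorm p).measurable

theorem lpNorm_smul {n : ℕ} {p : ℝ≥0∞} (hp : 1 ≤ p) (c : ℝ) (x : Fin n → ℝ) :
    lpNorm p (c • x) = |c| * lpNorm p x := by
  have : Fact (1 ≤ p) := ⟨hp⟩
  simp only [lpNorm, WithLp.toLp_smul, norm_smul, Real.norm_eq_abs]

theorem measurableSet_unitBall {n : ℕ} {p : ℝ≥0∞} (hp : 1 ≤ p) :
    MeasurableSet (unitBall n p) :=
  measurableSet_le (measurable_lpNorm hp) measurable_const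

theorem volume_unitBall_ne_top {n : ℕ} {p : ℝ≥0∞} (hp : 1 ≤ p) :
    volume (unitBall n p) ≠ ∞ := by
  have : Fact (1 ≤ p) := ⟨hp⟩
  refine ((measure_mono fun x hx => ?_).trans_lt
    (isCompact_closedBall (0 : Fin n → ℝ) 1).measure_lt_top).ne
  rw [mem_closedBall_zero_iff]
  exact (pi_norm_le_iff_of_nonneg zero_le_one).2 fun i =>
    (PiLp.norm_apply_le (WithLp.toLp p x) i).trans hx

theorem volume_unitBall_ne_zero {n : ℕ} {p : ℝ≥0∞} (hp : 1 ≤ p) :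
    volume (unitBall n p) ≠ 0 := by
  have : Fact (1 ≤ p) := ⟨hp⟩
  have ho : IsOpen {x : Fin n → ℝ | lpNorm p x < 1} :=
    isOpen_lt (continuous_lpNorm p) continuous_const
  have hne : ({x : Fin n → ℝ | lpNorm p x < 1}).Nonempty := ⟨0, by simp [lpNorm]⟩
  exact ((ho.measure_pos volume hne).trans_le (measure_mono fun x hx => (mem_ofPred.1 hx).le)).ne'

theorem mem_unitBall_iff {n : ℕ} {p : ℝ≥0∞} (hp : 1 ≤ p) (hp' : p ≠ ∞) (x : Fin n → ℝ) :
    x ∈ unitBall n p ↔ ∑ i, |x i| ^ p.toReal ≤ 1 := by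
  have h0 : 0 < p.toReal := ENNReal.toReal_pos (by positivity) hp'
  have hs : 0 ≤ ∑ i, |x i| ^ p.toReal := by positivity
  rw [unitBall, mem_ofPred_eq, lpNorm_of_ne_top hp hp']
  have h := Real.rpow_le_rpow_iff hs zero_le_one (show 0 < 1 / p.toReal by positivity)
  rwa [Real.one_rpow] at h

theorem pi_withDensity_ofReal {n : ℕ} {f : ℝ → ℝ} (hf : Integrable f) (hf0 : ∀ x, 0 ≤ f x)
    [SigmaFinite (volume.withDensity fun x => ENNReal.ofReal (f x))] :
    Measure.pi (fun _ : Fin n => volume.withDensity fun x => ENNReal.ofReal (f x))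
      = volume.withDensity fun x : Fin n → ℝ => ENNReal.ofReal (∏ i, f (x i)) := by
  refine Measure.pi_eq fun s hs => ?_
  have hsf : ∀ i, Integrable ((s i).indicator f) := fun i => hf.indicator (hs i)
  rw [withDensity_apply _ (MeasurableSet.univ_pi hs),
    ← lintegral_indicator (MeasurableSet.univ_pi hs)]
  have h1 : ∀ x : Fin n → ℝ, (univ.pi s).indicator (fun x => ENNReal.ofReal (∏ i, f (x i))) x
      = ENNReal.ofReal (∏ i, (s i).indicator f (x i)) := by
    intro x
    by_cases hx : x ∈ univ.pi s
    · rw [indicator_of_mem hx]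
      congr 1
      exact Finset.prod_congr rfl fun i _ => (indicator_of_mem (hx i (mem_univ i)) _).symm
    · rw [indicator_of_notMem hx]
      simp only [mem_univ_pi, not_forall] at hx
      obtain ⟨i, hi⟩ := hx
      rw [Finset.prod_eq_zero (Finset.mem_univ i) (indicator_of_notMem hi _), ENNReal.ofReal_zero]
  simp_rw [h1]
  rw [← ofReal_integral_eq_lintegral_ofReal (μ := (volume : Measure (Fin n → ℝ)))
      (Integrable.fintype_prod fun i => hsf i)
    (ae_of_all _ fun x => Finset.prod_nonneg fun i _ => indicator_nonneg (fun y _ => hf0 y) _),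
    integral_fintype_prod_volume_eq_prod (fun i => (s i).indicator f), ENNReal.ofReal_prod_of_nonneg
      fun i _ => integral_nonneg fun y => indicator_nonneg (fun y _ => hf0 y) _]
  refine Finset.prod_congr rfl fun i _ => ?_
  rw [withDensity_apply _ (hs i), integral_indicator (hs i),
    ofReal_integral_eq_lintegral_ofReal hf.integrableOn (ae_of_all _ hf0)]

theorem integrable_pGaussianPDF {p : ℝ} (hp : 0 < p) : Integrable (pGaussianPDF p) := by
  have := isProbabilityMeasure_pGaussian hp
  have h := integral_pGaussian hp fun _ => 1
  simp only [integral_const, probReal_univ, smul_eq_mul, mul_one] at h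
  exact integrable_of_integral_eq_one h.symm

theorem lintegral_comp_smul {n : ℕ} {H : (Fin n → ℝ) → ℝ≥0∞} (hH : Measurable H) {c : ℝ}
    (hc : c ≠ 0) :
    ∫⁻ y, H (c • y) = ENNReal.ofReal |(c ^ n)⁻¹| * ∫⁻ y, H y := by
  rw [← lintegral_map (μ := volume) (g := fun y : Fin n → ℝ => c • y) hH (by fun_prop),
    Measure.map_addHaar_smul _ hc, lintegral_smul_measure]
  simp

/-- The rescaling of `y` that turns independent `p`-generalized Gaussian coordinates and an
independent exponential variable `w` into a uniformly distributed point of the `ℓ_p` ball. -/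
noncomputable def ballPoint {n : ℕ} (p : ℝ) (w : ℝ) (y : Fin n → ℝ) : Fin n → ℝ :=
  (∑ i, |y i| ^ p + w) ^ (-(1 / p)) • y

theorem measurable_ballPoint {n : ℕ} {p : ℝ} :
    Measurable fun z : ℝ × (Fin n → ℝ) => ballPoint p z.1 z.2 := by
  unfold ballPoint
  fun_prop

/-- The joint density of `(w, y)` depends only on `s = N y + w`, on the region `w ≥ 0`. With `s` as
variable instead of `w`, for fixed `s` the point `y` ranges over `{N ≤ s}` with constant density,
and `s ^ (-1/p)` scales this set to the unit ball. The law is thus a multiple of volume on the ball;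
total mass 1 fixes the factor, so no explicit volume formula is needed. -/
theorem map_ballPoint {n : ℕ} {p : ℝ≥0∞} (hp : 1 ≤ p) (hp' : p ≠ ∞) :
    ((expMeasure (1 / p.toReal)).prod (Measure.pi fun _ : Fin n => pGaussian p.toReal)).map
      (fun z => ballPoint p.toReal z.1 z.2) = ProbabilityTheory.cond volume (unitBall n p) := by
  have h0 : 0 < p.toReal := ENNReal.toReal_pos (by positivity) hp'
  have hmem := fun x => mem_unitBall_iff (n := n) hp hp' x
  set r := p.toReal with hr
  have : IsProbabilityMeasure (pGaussian r) := isProbabilityMeasure_pGaussian h0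
  have : IsProbabilityMeasure (expMeasure (1 / r)) :=
    isProbabilityMeasure_expMeasure (by positivity)
  set N : (Fin n → ℝ) → ℝ := fun y => ∑ i, |y i| ^ r with hN
  have hNm : Measurable N := by fun_prop
  have hN0 : ∀ y, 0 ≤ N y := fun y => by positivity
  set D : ℝ → ℝ≥0∞ := fun s => ENNReal.ofReal ((K r / 2) ^ n * (1 / r) * Real.exp (-(1 / r) * s))
    with hD
  have hDm : Measurable D := by fun_prop
  have : IsProbabilityMeasure (volume.withDensity fun x => ENNReal.ofReal (pGaussianPDF r x)) :=
    isProbabilityMeasure_pGaussian h0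
  have hpi : Measure.pi (fun _ : Fin n => pGaussian r) = volume.withDensity fun y =>
      ENNReal.ofReal (∏ i, pGaussianPDF r (y i)) :=
    pi_withDensity_ofReal (integrable_pGaussianPDF h0) fun x => (pGaussianPDF_pos h0 x).le
  have hdens : ∀ (w : ℝ) (y : Fin n → ℝ), exponentialPDF (1 / r) w *
      ENNReal.ofReal (∏ i, pGaussianPDF r (y i)) = (Ici (0 : ℝ)).indicator 1 w * D (N y + w) := by
    intro w y
    by_cases hw : 0 ≤ w
    · rw [exponentialPDF_of_nonneg hw, ← ENNReal.ofReal_mul (by positivity),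
        indicator_of_mem (show w ∈ Ici 0 from hw), Pi.one_apply, one_mul]
      simp only [hD, hN, pGaussianPDF]
      congr 1
      rw [Finset.prod_mul_distrib, ← Real.exp_sum, ← Finset.mul_sum, mul_add, Real.exp_add]
      simp only [Finset.prod_const, Finset.card_univ, Fintype.card_fin]
      ring_nf
    · rw [exponentialPDF_of_neg (not_le.1 hw), indicator_of_notMem (by simpa using hw)]
      simp
  have key : ∃ C : ℝ≥0∞, ∀ A, MeasurableSet A →
      ((expMeasure (1 / r)).prod (Measure.pi fun _ : Fin n => pGaussian r)).map
      (fun z => ballPoint r z.1 z.2) A = C * volume (unitBall n p ∩ A) := by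
    -- The constant integrates the common density against the Jacobian of the scaling by `s ^
    -- (-1/r)`; it does not depend on `A`.
    refine ⟨∫⁻ s, (Ioi (0 : ℝ)).indicator (fun s => D s *
      ENNReal.ofReal |((s ^ (-(1 / r))) ^ n)⁻¹|) s, fun A hA => ?_⟩
    have hBA : MeasurableSet (unitBall n p ∩ A) := (measurableSet_unitBall hp).inter hA
    set G : (Fin n → ℝ) → ℝ → ℝ≥0∞ := fun y s =>
      (Ici (N y)).indicator 1 s * D s * A.indicator 1 (s ^ (-(1 / r)) • y) with hG
    have hA1 : Measurable (A.indicator (1 : (Fin n → ℝ) → ℝ≥0∞)) := measurable_one.indicator hA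
    have hGm : Measurable (Function.uncurry G) := by
      have h1 : Measurable fun z : (Fin n → ℝ) × ℝ => (Ici (N z.1)).indicator (1 : ℝ → ℝ≥0∞) z.2 := by
        have : (fun z : (Fin n → ℝ) × ℝ => (Ici (N z.1)).indicator (1 : ℝ → ℝ≥0∞) z.2)
            = {z : (Fin n → ℝ) × ℝ | N z.1 ≤ z.2}.indicator 1 := by
          ext z
          simp [indicator]
        rw [this]
        exact measurable_one.indicator (measurableSet_le (by fun_prop) (by fun_prop))
      have h2 : Measurable fun z : (Fin n → ℝ) × ℝ => z.2 ^ (-(1 / r)) • z.1 := by fun_prop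
      exact (h1.mul (hDm.comp measurable_snd)).mul (hA1.comp h2)
    rw [← lintegral_indicator_one hA, lintegral_map (measurable_one.indicator hA)
      measurable_ballPoint, hpi]
    change ∫⁻ z, _ ∂((volume.withDensity (exponentialPDF (1 / r))).prod _) = _
    have hem : Measurable (exponentialPDF (1 / r)) :=
      (measurable_exponentialPDFReal _).ennreal_ofReal
    have hfm : Measurable fun y : Fin n → ℝ => ENNReal.ofReal (∏ i, pGaussianPDF r (y i)) := by
      have := measurable_pGaussianPDF (p := r)
      fun_prop
    have hball : Measurable fun z : ℝ × (Fin n → ℝ) =>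
        A.indicator (1 : (Fin n → ℝ) → ℝ≥0∞) (ballPoint r z.1 z.2) :=
      hA1.comp measurable_ballPoint
    have hdm : Measurable fun z : ℝ × (Fin n → ℝ) =>
        exponentialPDF (1 / r) z.1 * ENNReal.ofReal (∏ i, pGaussianPDF r (z.2 i)) :=
      (hem.comp measurable_fst).mul (hfm.comp measurable_snd)
    rw [prod_withDensity hem hfm, lintegral_withDensity_eq_lintegral_mul _ hdm hball]
    have hm1 := hdm.mul hball
    simp only [Pi.mul_apply, hdens] at hm1 ⊢
    rw [lintegral_prod_symm']
    · have h1 : ∀ y : Fin n → ℝ, ∫⁻ w, (Ici (0 : ℝ)).indicator 1 w * D (N y + w) *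
          A.indicator 1 (ballPoint r w y) = ∫⁻ s, G y s := by
        intro y
        rw [← lintegral_add_left_eq_self (G y) (N y)]
        congr 1
        ext w
        have hind : (Ici (0 : ℝ)).indicator (1 : ℝ → ℝ≥0∞) w = (Ici (N y)).indicator 1 (N y + w) := by
          simp [indicator]
        rw [hind]
        rfl
      simp only [h1]
      rw [lintegral_lintegral_swap hGm.aemeasurable, ← lintegral_mul_const _ ((Measurable.indicator (by fun_prop) measurableSet_Ioi))]
      refine lintegral_congr_ae ?_
      filter_upwards [Measure.ae_ne volume (0 : ℝ)] with s hs
      rcases lt_or_gt_of_ne hs with hs | hs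
      · rw [indicator_of_notMem (by simpa using hs.le), zero_mul]
        refine (lintegral_congr fun y => ?_).trans lintegral_zero
        simp only [hG]
        rw [indicator_of_notMem (show s ∉ Ici (N y) from not_le.2 (hs.trans_le (hN0 y))), zero_mul,
          zero_mul]
      · rw [indicator_of_mem (show s ∈ Ioi 0 from hs), mul_assoc,
          ← lintegral_indicator_one hBA, ← lintegral_comp_smul (measurable_one.indicator hBA)
          (by positivity), ← lintegral_const_mul _ (show Measurable fun y : Fin n → ℝ =>
            (unitBall n p ∩ A).indicator (1 : (Fin n → ℝ) → ℝ≥0∞) (s ^ (-(1 / r)) • y) from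
              (measurable_one.indicator hBA).comp (measurable_const_smul _))]
        refine lintegral_congr fun y => ?_
        have hNs : N (s ^ (-(1 / r)) • y) = s⁻¹ * N y := by
          simp only [hN, Pi.smul_apply, smul_eq_mul, Finset.mul_sum]
          refine Finset.sum_congr rfl fun i _ => ?_
          rw [abs_mul, abs_of_pos (by positivity), Real.mul_rpow (by positivity) (abs_nonneg _),
            ← Real.rpow_mul hs.le, neg_mul, one_div_mul_cancel h0.ne', Real.rpow_neg_one]
        have hB : s ^ (-(1 / r)) • y ∈ unitBall n p ↔ N y ≤ s := by
          rw [hmem]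
          change N (s ^ (-(1 / r)) • y) ≤ 1 ↔ _
          rw [hNs, inv_mul_le_iff₀ hs, mul_one]
        simp only [hG]
        by_cases hy : N y ≤ s
        · rw [indicator_of_mem (show s ∈ Ici (N y) from hy), Pi.one_apply, one_mul]
          congr 1
          by_cases hyA : s ^ (-(1 / r)) • y ∈ A
          · rw [indicator_of_mem hyA, indicator_of_mem (mem_inter (hB.2 hy) hyA)]
          · rw [indicator_of_notMem hyA, indicator_of_notMem fun h => hyA h.2]
        · rw [indicator_of_notMem (show s ∉ Ici (N y) from hy),
            indicator_of_notMem (show s ^ (-(1 / r)) • y ∉ unitBall n p ∩ A from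
              fun h => hy (hB.1 h.1))]
          simp
    · exact hm1
  obtain ⟨C, hC⟩ := key
  have : IsProbabilityMeasure (((expMeasure (1 / r)).prod (Measure.pi fun _ : Fin n =>
      pGaussian r)).map (fun z => ballPoint r z.1 z.2)) :=
    Measure.isProbabilityMeasure_map measurable_ballPoint.aemeasurable
  have hCv : C * volume (unitBall n p) = 1 := by
    have := hC univ MeasurableSet.univ
    rwa [measure_univ, inter_univ, eq_comm] at this
  ext A hA
  rw [hC A hA, ProbabilityTheory.cond_apply (measurableSet_unitBall hp),
    ENNReal.eq_inv_of_mul_eq_one_left hCv]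

end Representation

/-! ### One probability space carrying the model for all `n` -/

section Model

noncomputable section

/-- The law of the coordinates in the probabilistic model of the `ℓ_p` ball. -/
def coordLaw (p : ℝ≥0∞) : Measure ℝ :=
  if p = ∞ then ProbabilityTheory.cond volume (Icc (-1 : ℝ) 1) else pGaussian p.toReal

/-- The law of the radial variable in the probabilistic model of the `ℓ_p` ball. -/
def radialLaw (p : ℝ≥0∞) : Measure ℝ :=
  if p = ∞ then Measure.dirac 0 else expMeasure (1 / p.toReal)

/-- The law of the radial variable and of the independent sequence of coordinates. -/
def modelMeasure (p : ℝ≥0∞) : Measure (ℝ × (ℕ → ℝ)) :=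
  (radialLaw p).prod (Measure.infinitePi fun _ => coordLaw p)

end

variable {p : ℝ≥0∞}

theorem toReal_pos_of_one_le (hp : 1 ≤ p) (hp' : p ≠ ∞) : 0 < p.toReal :=
  ENNReal.toReal_pos (by positivity) hp'

theorem isProbabilityMeasure_coordLaw (hp : 1 ≤ p) : IsProbabilityMeasure (coordLaw p) := by
  unfold coordLaw
  split_ifs with h
  · exact cond_isProbabilityMeasure_of_finite (by simp) (by simp)
  · exact isProbabilityMeasure_pGaussian (toReal_pos_of_one_le hp h)

theorem isProbabilityMeasure_radialLaw (hp : 1 ≤ p) : IsProbabilityMeasure (radialLaw p) := by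
  unfold radialLaw
  split_ifs with h
  · infer_instance
  · have := toReal_pos_of_one_le hp h
    exact isProbabilityMeasure_expMeasure (by positivity)

theorem isProbabilityMeasure_modelMeasure (hp : 1 ≤ p) :
    IsProbabilityMeasure (modelMeasure p) := by
  have := isProbabilityMeasure_coordLaw hp
  have := isProbabilityMeasure_radialLaw hp
  unfold modelMeasure
  infer_instance

theorem map_eval_modelMeasure (hp : 1 ≤ p) (k : ℕ) :
    (modelMeasure p).map (fun z => z.2 k) = coordLaw p := by
  have := isProbabilityMeasure_coordLaw hp
  have := isProbabilityMeasure_radialLaw hp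
  exact ((measurePreserving_eval_infinitePi (fun _ : ℕ => coordLaw p) k).comp
    measurePreserving_snd).map_eq

theorem identDistrib_modelMeasure (hp : 1 ≤ p) (k : ℕ) :
    IdentDistrib (fun z : ℝ × (ℕ → ℝ) => z.2 k) (fun z => z.2 0) (modelMeasure p)
      (modelMeasure p) :=
  ⟨by fun_prop, by fun_prop, by rw [map_eval_modelMeasure hp, map_eval_modelMeasure hp]⟩

theorem iIndepFun_modelMeasure (hp : 1 ≤ p) :
    iIndepFun (fun (k : ℕ) (z : ℝ × (ℕ → ℝ)) => z.2 k) (modelMeasure p) := by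
  have := isProbabilityMeasure_coordLaw hp
  have := isProbabilityMeasure_radialLaw hp
  have := isProbabilityMeasure_modelMeasure hp
  rw [iIndepFun_iff_map_fun_eq_infinitePi_map (by fun_prop)]
  simp_rw [map_eval_modelMeasure hp]
  exact measurePreserving_snd.map_eq

theorem map_restrict_infinitePi (μ : Measure ℝ) [IsProbabilityMeasure μ] (n : ℕ) :
    (Measure.infinitePi fun _ : ℕ => μ).map (fun y (i : Fin n) => y i)
      = Measure.pi fun _ : Fin n => μ := by
  have h := (iIndepFun_infinitePi (P := fun _ : ℕ => μ) (X := fun _ => id)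
    fun _ => measurable_id).precomp (Fin.val_injective (n := n))
  change iIndepFun (fun (i : Fin n) (y : ℕ → ℝ) => y i) _ at h
  have h2 := (iIndepFun_iff_map_fun_eq_pi_map (f := fun (i : Fin n) (y : ℕ → ℝ) => y i)
    fun i => (measurable_pi_apply (i : ℕ)).aemeasurable).1 h
  simpa [Measure.infinitePi_map_eval] using h2

theorem map_restrict_modelMeasure (hp : 1 ≤ p) (n : ℕ) :
    (modelMeasure p).map (fun z => (z.1, fun i : Fin n => z.2 i))
      = (radialLaw p).prod (Measure.pi fun _ : Fin n => coordLaw p) := by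
  have := isProbabilityMeasure_coordLaw hp
  have := isProbabilityMeasure_radialLaw hp
  rw [← map_restrict_infinitePi]
  exact ((MeasurePreserving.id (radialLaw p)).prod
    (Measurable.measurePreserving
      (f := fun (y : ℕ → ℝ) (i : Fin n) => y i) (by fun_prop) _)).map_eq

theorem integral_modelMeasure (hp : 1 ≤ p) {f : ℝ → ℝ} (hf : Measurable f) (k : ℕ) :
    ∫ z, f (z.2 k) ∂modelMeasure p = ∫ x, f x ∂coordLaw p := by
  rw [← map_eval_modelMeasure hp k, integral_map (by fun_prop) (by fun_prop)]

theorem memLp_modelMeasure (hp : 1 ≤ p) {f : ℝ → ℝ} (hf : Measurable f)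
    (h : MemLp f 2 (coordLaw p)) (k : ℕ) :
    MemLp (fun z : ℝ × (ℕ → ℝ) => f (z.2 k)) 2 (modelMeasure p) := by
  rw [← map_eval_modelMeasure hp k] at h
  exact (memLp_map_measure_iff (by fun_prop) (by fun_prop)).1 h

theorem ae_nonneg_modelMeasure (hp : 1 ≤ p) : ∀ᵐ z ∂modelMeasure p, 0 ≤ z.1 := by
  have := isProbabilityMeasure_coordLaw hp
  have := isProbabilityMeasure_radialLaw hp
  have h : ∀ᵐ w ∂radialLaw p, 0 ≤ w := by
    unfold radialLaw
    split_ifs with h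
    · simp
    · change ∀ᵐ w ∂volume.withDensity (exponentialPDF (1 / p.toReal)), 0 ≤ w
      have hm : Measurable (exponentialPDF (1 / p.toReal)) :=
        (measurable_exponentialPDFReal _).ennreal_ofReal
      rw [ae_withDensity_iff hm]
      refine ae_of_all _ fun w hw => ?_
      by_contra hneg
      exact hw (exponentialPDF_of_neg (not_le.1 hneg))
  exact (measurePreserving_fst (μ := radialLaw p)
    (ν := Measure.infinitePi fun _ : ℕ => coordLaw p)).quasiMeasurePreserving.ae h

theorem pi_cond_Icc (n : ℕ) :
    Measure.pi (fun _ : Fin n => ProbabilityTheory.cond volume (Icc (-1 : ℝ) 1))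
      = ProbabilityTheory.cond volume (unitBall n ∞) := by
  have hball : unitBall n ∞ = univ.pi fun _ : Fin n => Icc (-1 : ℝ) 1 := by
    ext x
    rw [unitBall, mem_ofPred_eq, mem_univ_pi]
    have : lpNorm ∞ x = ‖x‖ := by
      rw [lpNorm, PiLp.norm_toLp]
    rw [this, pi_norm_le_iff_of_nonneg zero_le_one]
    simp [abs_le]
  have : IsProbabilityMeasure (ProbabilityTheory.cond volume (Icc (-1 : ℝ) 1)) :=
    cond_isProbabilityMeasure_of_finite (by simp) (by simp)
  refine Measure.pi_eq fun s hs => ?_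
  rw [hball, ProbabilityTheory.cond_apply (MeasurableSet.univ_pi fun _ => measurableSet_Icc),
    ← pi_inter_distrib, volume_pi_pi, volume_pi_pi]
  simp_rw [ProbabilityTheory.cond_apply measurableSet_Icc]
  rw [Finset.prod_mul_distrib, ENNReal.prod_inv_distrib fun i _ j _ _ => Or.inl (by simp)]

/-- The distribution of the model point is uniform on the `ℓ_p` ball. -/
theorem map_ballPoint_modelMeasure (hp : 1 ≤ p) (n : ℕ) :
    (modelMeasure p).map (fun z => ballPoint p.toReal z.1 fun i : Fin n => z.2 i)
      = ProbabilityTheory.cond volume (unitBall n p) := by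
  have := isProbabilityMeasure_coordLaw hp
  have := isProbabilityMeasure_radialLaw hp
  change (modelMeasure p).map ((fun z : ℝ × (Fin n → ℝ) => ballPoint p.toReal z.1 z.2) ∘
    fun z => (z.1, fun i : Fin n => z.2 i)) = _
  rw [← Measure.map_map measurable_ballPoint (by fun_prop), map_restrict_modelMeasure hp]
  by_cases h : p = ∞
  · subst h
    -- Since `∞.toReal = 0` and `1 / 0 = 0`, the scaling factor has exponent 0 and equals 1.
    have hb : (fun z : ℝ × (Fin n → ℝ) => ballPoint (∞ : ℝ≥0∞).toReal z.1 z.2) = Prod.snd := by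
      ext z i
      simp [ballPoint]
    rw [hb, measurePreserving_snd.map_eq, ← pi_cond_Icc]
    simp [coordLaw]
  · rw [← map_ballPoint hp h]
    simp [coordLaw, radialLaw, h]

theorem integral_abs_rpow_coordLaw_top {r : ℝ} (hr : 0 ≤ r) :
    ∫ x, |x| ^ r ∂coordLaw ∞ = 1 / (r + 1) := by
  have h1 : ∫ x in Icc (-1 : ℝ) 1, |x| ^ r = 2 * (1 / (r + 1)) := by
    have h := integral_comp_abs (f := (Iic (1 : ℝ)).indicator fun x => x ^ r)
    have e : (fun x : ℝ => (Iic (1 : ℝ)).indicator (fun x => x ^ r) |x|)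
        = (Icc (-1 : ℝ) 1).indicator fun x => |x| ^ r := by
      ext x
      simp [indicator, abs_le]
    rw [e, integral_indicator measurableSet_Icc, integral_indicator measurableSet_Iic,
      Measure.restrict_restrict measurableSet_Iic, inter_comm, Ioi_inter_Iic,
      ← intervalIntegral.integral_of_le zero_le_one, integral_rpow (Or.inl (by linarith))] at h
    rw [h, Real.one_rpow, Real.zero_rpow (by linarith), sub_zero]
  rw [coordLaw, if_pos rfl, ProbabilityTheory.cond, integral_smul_measure, h1]
  norm_num
  ring

theorem M_eq_integral {r : ℝ≥0∞} (hp : 1 ≤ p) (hr : r ≠ ∞) :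
    M p r = ∫ x, |x| ^ r.toReal ∂coordLaw p := by
  by_cases h : p = ∞
  · subst h
    rw [integral_abs_rpow_coordLaw_top ENNReal.toReal_nonneg, M, if_pos rfl, if_neg hr]
  · rw [M_eq_integral_pGaussian hp h, coordLaw, if_neg h]

theorem M_pos {r : ℝ≥0∞} (hp : 1 ≤ p) (hr : r ≠ ∞) : 0 < M p r := by
  have hr0 : 0 ≤ r.toReal := ENNReal.toReal_nonneg
  unfold M
  split_ifs with h
  · positivity
  · have h0 := toReal_pos_of_one_le hp h
    have h3 := Real.Gamma_pos_of_pos (s := 1 + 1 / p.toReal) (by positivity)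
    have h4 := Real.Gamma_pos_of_pos (s := 1 + (r.toReal + 1) / p.toReal) (by positivity)
    positivity

theorem integrable_abs_rpow_coordLaw (hp : 1 ≤ p) {r : ℝ} (hr : 0 ≤ r) :
    Integrable (fun x => |x| ^ r) (coordLaw p) := by
  -- A non-integrable function has Bochner integral 0, whereas the moment is positive.
  refine Integrable.of_integral_ne_zero ?_
  have h := M_eq_integral (r := ENNReal.ofReal r) hp ENNReal.ofReal_ne_top
  rw [ENNReal.toReal_ofReal hr] at h
  rw [← h]
  exact (M_pos hp ENNReal.ofReal_ne_top).ne'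

theorem memLp_abs_rpow_coordLaw (hp : 1 ≤ p) {r : ℝ} (hr : 0 ≤ r) :
    MemLp (fun x => |x| ^ r) 2 (coordLaw p) := by
  rw [memLp_two_iff_integrable_sq (by fun_prop)]
  refine (integrable_abs_rpow_coordLaw hp (r := r + r) (by positivity)).congr
    (ae_of_all _ fun x => ?_)
  simp only [pow_two]
  rw [Real.rpow_add_of_nonneg (abs_nonneg x) hr hr]

theorem M_self (hp : 1 ≤ p) (hp' : p ≠ ∞) : M p p = 1 := by
  have h0 := toReal_pos_of_one_le hp hp'
  have h3 := Real.Gamma_pos_of_pos (s := 1 + 1 / p.toReal) (by positivity)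
  rw [M, if_neg hp', div_self h0.ne', Real.rpow_one,
    show 1 + (p.toReal + 1) / p.toReal = (1 + 1 / p.toReal) + 1 by field_simp; ring,
    Real.Gamma_add_one (by positivity)]
  field_simp

/-- Normalisation that puts the base point of the delta method at 1. For `p = ∞` the integrand is
`|x| ^ 0 = 1`. -/
theorem integral_abs_rpow_self (hp : 1 ≤ p) : ∫ x, |x| ^ p.toReal ∂coordLaw p = 1 := by
  by_cases h : p = ∞
  · have := isProbabilityMeasure_coordLaw hp
    have h0 : p.toReal = 0 := by simp [h]
    simp [h0]
  · rw [← M_eq_integral hp h, M_self hp h]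

theorem covariance_abs_rpow {r s : ℝ≥0∞} (hp : 1 ≤ p) (hr : r ≠ ∞) (hs : s ≠ ∞) :
    cov[fun x => |x| ^ r.toReal, fun x => |x| ^ s.toReal; coordLaw p] = C p r s := by
  have := isProbabilityMeasure_coordLaw hp
  rw [covariance_eq_sub (memLp_abs_rpow_coordLaw hp ENNReal.toReal_nonneg)
    (memLp_abs_rpow_coordLaw hp ENNReal.toReal_nonneg), C, M_eq_integral hp hr,
    M_eq_integral hp hs, M_eq_integral hp (ENNReal.add_ne_top.2 ⟨hr, hs⟩), ENNReal.toReal_add hr hs]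
  congr 2
  ext x
  rw [Pi.mul_apply, Real.rpow_add_of_nonneg (abs_nonneg x) ENNReal.toReal_nonneg
    ENNReal.toReal_nonneg]

end Model

/-! ### The Gaussian limit and its covariance matrix -/

section Gaussian

theorem one_div_toReal (p : ℝ≥0∞) : 1 / p.toReal = p⁻¹.toReal := by
  rw [ENNReal.toReal_inv, one_div]

theorem lpNorm_ballPoint {n : ℕ} {q : ℝ≥0∞} (hq : 1 ≤ q) {r w : ℝ} (hw : 0 ≤ w)
    (y : Fin n → ℝ) :
    lpNorm q (ballPoint r w y) = (∑ i, |y i| ^ r + w) ^ (-(1 / r)) * lpNorm q y := by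
  rw [ballPoint, lpNorm_smul hq, abs_of_nonneg (by positivity)]

theorem sqrt_mul_lpNorm_ballPoint {n : ℕ} {p q : ℝ≥0∞} (hq : 1 ≤ q) (hq' : q ≠ ∞) {w m : ℝ}
    (hw : 0 ≤ w) (hm : 0 < m) (y : ℕ → ℝ) :
    √n * (((∑ k ∈ Finset.range n, |y k| ^ q.toReal / m) / n) ^ (1 / q.toReal) *
        ((∑ k ∈ Finset.range n, |y k| ^ p.toReal) / n + w / n) ^ (-(1 / p.toReal)) - 1)
      = √n * ((n : ℝ) ^ (p⁻¹.toReal - q⁻¹.toReal) *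
        (lpNorm q (ballPoint p.toReal w fun i : Fin n => y i) / m ^ (1 / q.toReal)) - 1) := by
  rcases Nat.eq_zero_or_pos n with rfl | hn
  · simp
  have hn' : (0 : ℝ) < n := Nat.cast_pos.2 hn
  have hq0 := toReal_pos_of_one_le hq hq'
  rw [lpNorm_ballPoint hq hw, lpNorm_of_ne_top hq hq', Finset.sum_range, Finset.sum_range,
    ← add_div, ← one_div_toReal, ← one_div_toReal, ← Finset.sum_div]
  rw [Real.div_rpow (by positivity) hn'.le, Real.div_rpow (by positivity) hm.le,
    Real.div_rpow (by positivity) hn'.le, Real.rpow_sub hn', Real.rpow_neg hn'.le]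
  field_simp

/-- The factor `p⁻¹` is what lets finite and infinite `p` share one formula: it vanishes at `p = ∞`,
where the moment formula behind `C p q p` is only a convention. -/
theorem mul_C_div {p q : ℝ≥0∞} (hp : 1 ≤ p) (hq : q ≠ ∞) :
    p⁻¹.toReal * (C p q p / (q.toReal * M p q)) = 1 / q.toReal * (p⁻¹.toReal *
      (cov[fun x => |x| ^ q.toReal / M p q, fun x => |x| ^ p.toReal; coordLaw p])) := by
  by_cases h : p = ∞
  · simp [h]
  · rw [covariance_fun_div_left, covariance_abs_rpow hp hq h]
    field_simp

theorem limitCov_eq_covariance {d : ℕ} {p : ℝ≥0∞} (hp : 1 ≤ p) {q : Fin d → ℝ≥0∞}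
    (hq' : ∀ i, q i ≠ ∞) (i j : Fin d) :
    limitCov p q i j =
      cov[fun x => 1 / (q i).toReal * (|x| ^ (q i).toReal / M p (q i))
          + -(1 / p.toReal) * |x| ^ p.toReal,
        fun x => 1 / (q j).toReal * (|x| ^ (q j).toReal / M p (q j))
          + -(1 / p.toReal) * |x| ^ p.toReal; coordLaw p] := by
  have := isProbabilityMeasure_coordLaw hp
  have hg : ∀ i, MemLp (fun x => |x| ^ (q i).toReal / M p (q i)) 2 (coordLaw p) := fun i => by
    simp_rw [div_eq_inv_mul]
    exact (memLp_abs_rpow_coordLaw hp ENNReal.toReal_nonneg).const_mul _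
  have hh : MemLp (fun x => |x| ^ p.toReal) 2 (coordLaw p) :=
    memLp_abs_rpow_coordLaw hp ENNReal.toReal_nonneg
  have e : ∀ i, (fun x => 1 / (q i).toReal * (|x| ^ (q i).toReal / M p (q i))
      + -(1 / p.toReal) * |x| ^ p.toReal) = (1 / (q i).toReal) •
      (fun x => |x| ^ (q i).toReal / M p (q i)) + (-(1 / p.toReal)) • fun x => |x| ^ p.toReal := by
    intro i
    rfl
  rw [e, e, covariance_add_left ((hg i).const_smul _) (hh.const_smul _)
    (((hg j).const_smul _).add (hh.const_smul _)),
    covariance_add_right ((hg i).const_smul _) ((hg j).const_smul _) (hh.const_smul _),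
    covariance_add_right (hh.const_smul _) ((hg j).const_smul _) (hh.const_smul _)]
  simp only [covariance_smul_left, covariance_smul_right]
  rw [covariance_comm (fun x => |x| ^ p.toReal) (fun x => |x| ^ (q j).toReal / M p (q j)),
    limitCov, Matrix.of_apply, mul_add p⁻¹.toReal, mul_C_div hp (hq' i), mul_C_div hp (hq' j),
    covariance_fun_div_left (X := fun x => |x| ^ (q i).toReal)
      (Y := fun x => |x| ^ (q j).toReal / M p (q j)),
    covariance_fun_div_right (X := fun x => |x| ^ (q i).toReal),
    covariance_abs_rpow hp (hq' i) (hq' j), one_div_toReal p]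
  have hpp : p⁻¹.toReal ^ 2 * C p p p = p⁻¹.toReal ^ 2 *
      cov[fun x => |x| ^ p.toReal, fun x => |x| ^ p.toReal; coordLaw p] := by
    by_cases h : p = ∞
    · simp [h]
    · rw [covariance_abs_rpow hp h h]
  rw [hpp]
  have hMi := (M_pos hp (hq' i)).ne'
  have hMj := (M_pos hp (hq' j)).ne'
  field_simp
  ring

theorem posSemidef_and_tendstoInDistribution_model {d : ℕ} {p : ℝ≥0∞} (hp : 1 ≤ p)
    {q : Fin d → ℝ≥0∞} (hq : ∀ i, 1 ≤ q i) (hq' : ∀ i, q i ≠ ∞)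
    [IsProbabilityMeasure (modelMeasure p)] :
    (limitCov p q).PosSemidef ∧
    TendstoInDistribution
      (fun (n : ℕ) z => (WithLp.toLp 2 fun i =>
        √n * ((n : ℝ) ^ (p⁻¹.toReal - (q i)⁻¹.toReal) *
          (lpNorm (q i) (ballPoint p.toReal z.1 fun i : Fin n => z.2 i) /
            M p (q i) ^ (1 / (q i).toReal)) - 1) : EuclideanSpace ℝ (Fin d)))
      atTop id (fun _ => modelMeasure p) (multivariateGaussian 0 (limitCov p q)) := by
  have := isProbabilityMeasure_coordLaw hp
  have hgm : ∀ i, Measurable fun x : ℝ => |x| ^ (q i).toReal / M p (q i) := fun i => by fun_prop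
  have hhm : Measurable fun x : ℝ => |x| ^ p.toReal := by fun_prop
  have hg : ∀ i, MemLp (fun x => |x| ^ (q i).toReal / M p (q i)) 2 (coordLaw p) := fun i => by
    simp_rw [div_eq_inv_mul]
    exact (memLp_abs_rpow_coordLaw hp ENNReal.toReal_nonneg).const_mul _
  have hh : MemLp (fun x => |x| ^ p.toReal) 2 (coordLaw p) :=
    memLp_abs_rpow_coordLaw hp ENNReal.toReal_nonneg
  have hg1 : ∀ i, ∫ x, |x| ^ (q i).toReal / M p (q i) ∂coordLaw p = 1 := fun i => by
    rw [integral_div, ← M_eq_integral hp (hq' i), div_self (M_pos hp (hq' i)).ne']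
  obtain ⟨hpsd, h⟩ := tendstoInDistribution_sqrt_mul_rpow_mul_rpow (P := modelMeasure p)
    (Y := fun k z => z.2 k) (W := fun z => z.1)
    (g := fun i x => |x| ^ (q i).toReal / M p (q i)) (h := fun x => |x| ^ p.toReal)
    (b := fun i => 1 / (q i).toReal) (a := -(1 / p.toReal)) (S := limitCov p q)
    (by fun_prop) measurable_fst (iIndepFun_modelMeasure hp) (identDistrib_modelMeasure hp)
    hgm hhm (fun i => memLp_modelMeasure hp (hgm i) (hg i) 0) (memLp_modelMeasure hp hhm hh 0)
    (fun i => (integral_modelMeasure hp (hgm i) 0).trans (hg1 i))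
    ((integral_modelMeasure hp hhm 0).trans (integral_abs_rpow_self hp))
    (fun i j => by
      have hi : ∀ i, ∫ x, (1 / (q i).toReal * (|x| ^ (q i).toReal / M p (q i))
          + -(1 / p.toReal) * |x| ^ p.toReal) ∂coordLaw p
          = 1 / (q i).toReal + -(1 / p.toReal) := fun i => by
        rw [integral_add (((hg i).integrable (by norm_num)).const_mul _)
          ((hh.integrable (by norm_num)).const_mul _), integral_const_mul, integral_const_mul,
          hg1, integral_abs_rpow_self hp, mul_one, mul_one]
      rw [limitCov_eq_covariance hp hq', covariance, hi, hi]
      refine (integral_modelMeasure hp (f := fun x =>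
        (1 / (q i).toReal * (|x| ^ (q i).toReal / M p (q i) - 1)
          + -(1 / p.toReal) * (|x| ^ p.toReal - 1)) *
        (1 / (q j).toReal * (|x| ^ (q j).toReal / M p (q j) - 1)
          + -(1 / p.toReal) * (|x| ^ p.toReal - 1))) (by fun_prop) 0).trans ?_
      congr 1
      ext x
      ring)
  refine ⟨hpsd, h.congr (fun n => ?_) (ae_of_all _ fun _ => rfl)⟩
  filter_upwards [ae_nonneg_modelMeasure hp] with z hz
  congr 1
  ext i
  exact sqrt_mul_lpNorm_ballPoint (hq i) (hq' i) hz (M_pos hp (hq' i)) z.2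

/-- The recursion `Γ(x + 1) = x Γ(x)` gives `M_p(r + p) = (r + 1) M_p(r)`, hence `C_p(r, p) = r
M_p(r)`. The terms involving `p` then collapse to `1/p - 2/p`. -/
theorem limitCov_eq_of_ne_top {d : ℕ} {p : ℝ≥0∞} (hp : 1 ≤ p) (hp' : p ≠ ∞)
    {q : Fin d → ℝ≥0∞} (hq : ∀ i, 1 ≤ q i) (hq' : ∀ i, q i ≠ ∞) (i j : Fin d) :
    limitCov p q i j =
      1 / ((q i).toReal * (q j).toReal) *
        (Real.Gamma (1 / p.toReal) *
            Real.Gamma (((q i).toReal + (q j).toReal + 1) / p.toReal) /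
          (Real.Gamma (((q i).toReal + 1) / p.toReal) *
            Real.Gamma (((q j).toReal + 1) / p.toReal)) - 1) - 1 / p.toReal := by
  have h0 := toReal_pos_of_one_le hp hp'
  have hM : ∀ r : ℝ≥0∞, M p r = p.toReal ^ (r.toReal / p.toReal) *
      (Real.Gamma ((r.toReal + 1) / p.toReal) / Real.Gamma (1 / p.toReal)) := by
    intro r
    have hr : 0 ≤ r.toReal := ENNReal.toReal_nonneg
    have h3 := Real.Gamma_pos_of_pos (s := 1 / p.toReal) (by positivity)
    rw [M, if_neg hp', add_comm 1, add_comm 1, Real.Gamma_add_one (by positivity),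
      Real.Gamma_add_one (by positivity)]
    field_simp
  have hMadd : ∀ r : ℝ≥0∞, r ≠ ∞ → M p (r + p) = (r.toReal + 1) * M p r := by
    intro r hr
    have hr0 : 0 ≤ r.toReal := ENNReal.toReal_nonneg
    rw [hM, hM, ENNReal.toReal_add hr hp', add_div, div_self h0.ne', Real.rpow_add h0,
      Real.rpow_one, show (r.toReal + p.toReal + 1) / p.toReal = (r.toReal + 1) / p.toReal + 1 by
        field_simp; ring, Real.Gamma_add_one (by positivity)]
    field_simp
  have hqi := toReal_pos_of_one_le (hq i) (hq' i)
  have hqj := toReal_pos_of_one_le (hq j) (hq' j)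
  have hC : ∀ r : ℝ≥0∞, r ≠ ∞ → C p r p = r.toReal * M p r := by
    intro r hr
    rw [C, hMadd r hr, M_self hp hp']
    ring
  have hG : ∀ r : ℝ≥0∞, 0 < Real.Gamma ((r.toReal + 1) / p.toReal) := fun r =>
    Real.Gamma_pos_of_pos (by have : 0 ≤ r.toReal := ENNReal.toReal_nonneg; positivity)
  have hG0 := Real.Gamma_pos_of_pos (s := 1 / p.toReal) (by positivity)
  have hMM : M p (q i + q j) / (M p (q i) * M p (q j)) = Real.Gamma (1 / p.toReal) *
      Real.Gamma (((q i).toReal + (q j).toReal + 1) / p.toReal) /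
      (Real.Gamma (((q i).toReal + 1) / p.toReal) *
        Real.Gamma (((q j).toReal + 1) / p.toReal)) := by
    have := hG (q i)
    have := hG (q j)
    rw [hM, hM, hM, ENNReal.toReal_add (hq' i) (hq' j), add_div, Real.rpow_add h0]
    field_simp
  have hMi := M_pos hp (hq' i)
  have hMj := M_pos hp (hq' j)
  rw [← hMM, limitCov, Matrix.of_apply, hC _ (hq' i), hC _ (hq' j), hC _ hp', M_self hp hp', C,
    ← one_div_toReal]
  field_simp
  ring

theorem limitCov_eq_of_top {d : ℕ} {q : Fin d → ℝ≥0∞} (hq : ∀ i, 1 ≤ q i) (hq' : ∀ i, q i ≠ ∞)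
    (i j : Fin d) : limitCov ∞ q i j = 1 / ((q i).toReal + (q j).toReal + 1) := by
  have hqi := toReal_pos_of_one_le (hq i) (hq' i)
  have hqj := toReal_pos_of_one_le (hq j) (hq' j)
  have h : q i + q j ≠ ∞ := ENNReal.add_ne_top.2 ⟨hq' i, hq' j⟩
  simp only [limitCov, Matrix.of_apply, C, M, if_true, hq' i, hq' j, h, if_false,
    ENNReal.toReal_add (hq' i) (hq' j), ENNReal.inv_top, ENNReal.toReal_zero]
  field_simp
  ring

end Gaussian

/-! ### The radial distribution and the exponential limit -/

section Exponential

variable {Ω : Type*} [MeasurableSpace Ω] {P : Measure Ω}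

theorem aemeasurable_of_isUniform_unitBall {n : ℕ} {p : ℝ≥0∞} (hp : 1 ≤ p)
    {Z : Ω → Fin n → ℝ} (hZ : pdf.IsUniform Z (unitBall n p) P volume) : AEMeasurable Z P :=
  hZ.aemeasurable (volume_unitBall_ne_zero hp) (volume_unitBall_ne_top hp)

open scoped Pointwise in
theorem measureReal_lpNorm_le {n : ℕ} {p : ℝ≥0∞} (hp : 1 ≤ p)
    {Z : Ω → Fin n → ℝ} (hZ : pdf.IsUniform Z (unitBall n p) P volume) {ρ : ℝ} (h0 : 0 < ρ)
    (h1 : ρ ≤ 1) : P.real {ω | lpNorm p (Z ω) ≤ ρ} = ρ ^ n := by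
  have hm : MeasurableSet {x : Fin n → ℝ | lpNorm p x ≤ ρ} :=
    measurableSet_le (measurable_lpNorm hp) measurable_const
  have hball : unitBall n p ∩ {x : Fin n → ℝ | lpNorm p x ≤ ρ} = ρ • unitBall n p := by
    ext x
    rw [mem_smul_set_iff_inv_smul_mem₀ h0.ne']
    simp only [unitBall, mem_inter_iff, mem_ofPred_eq]
    rw [lpNorm_smul hp, abs_of_pos (inv_pos.2 h0), inv_mul_le_iff₀ h0, mul_one]
    exact ⟨fun h => h.2, fun h => ⟨h.trans h1, h⟩⟩
  have h := hZ.measure_preimage (volume_unitBall_ne_zero hp) (volume_unitBall_ne_top hp) hm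
  rw [hball, Measure.addHaar_smul, ENNReal.mul_div_cancel_right (volume_unitBall_ne_zero hp)
    (volume_unitBall_ne_top hp)] at h
  rw [measureReal_def]
  change (P (Z ⁻¹' {x | lpNorm p x ≤ ρ})).toReal = _
  rw [h, Module.finrank_fin_fun, abs_of_pos (by positivity), ENNReal.toReal_ofReal (by positivity)]

variable [IsProbabilityMeasure P]

/-- Spheres carry no mass, because `r ^ n → ρ ^ n` as `r` increases to `ρ`. -/
theorem measureReal_lpNorm_lt {n : ℕ} {p : ℝ≥0∞} (hp : 1 ≤ p)
    {Z : Ω → Fin n → ℝ} (hZ : pdf.IsUniform Z (unitBall n p) P volume) {ρ : ℝ} (h0 : 0 < ρ)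
    (h1 : ρ ≤ 1) : P.real {ω | lpNorm p (Z ω) < ρ} = ρ ^ n := by
  refine le_antisymm ?_ ?_
  · rw [← measureReal_lpNorm_le hp hZ h0 h1]
    exact measureReal_mono fun ω hω => (mem_ofPred.1 hω).le
  · have ht : Tendsto (fun r : ℝ => r ^ n) (𝓝[<] ρ) (𝓝 (ρ ^ n)) :=
      ((continuous_pow n).tendsto ρ).mono_left nhdsWithin_le_nhds
    refine le_of_tendsto ht ?_
    filter_upwards [Ioo_mem_nhdsLT h0] with r hr
    rw [← measureReal_lpNorm_le hp hZ hr.1 (hr.2.le.trans h1)]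
    exact measureReal_mono fun ω hω => lt_of_le_of_lt hω hr.2

theorem measureReal_one_lt_lpNorm {n : ℕ} {p : ℝ≥0∞} (hp : 1 ≤ p)
    {Z : Ω → Fin n → ℝ} (hZ : pdf.IsUniform Z (unitBall n p) P volume) :
    P.real {ω | 1 < lpNorm p (Z ω)} = 0 := by
  have hm : NullMeasurableSet {ω | lpNorm p (Z ω) ≤ 1} P :=
    nullMeasurableSet_le ((measurable_lpNorm hp).comp_aemeasurable
      (aemeasurable_of_isUniform_unitBall hp hZ)) aemeasurable_const
  have := probReal_compl_eq_one_sub₀ hm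
  rw [measureReal_lpNorm_le hp hZ one_pos le_rfl, one_pow, sub_self] at this
  rw [← this]
  congr 1
  ext ω
  simp

end Exponential

theorem tendstoInDistribution_exponential {Ω : ℕ → Type*} [∀ n, MeasurableSpace (Ω n)]
    {P : ∀ n, Measure (Ω n)} [∀ n, IsProbabilityMeasure (P n)] {p : ℝ≥0∞} (hp : 1 ≤ p)
    {Z : ∀ n, Ω n → Fin n → ℝ} (hZ : ∀ n, pdf.IsUniform (Z n) (unitBall n p) (P n) volume) :
    TendstoInDistribution (fun (n : ℕ) (ω : Ω n) => (n : ℝ) * (1 - lpNorm p (Z n ω)))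
      atTop id P (expMeasure 1) := by
  have hm : ∀ n, AEMeasurable (fun ω => lpNorm p (Z n ω)) (P n) := fun n =>
    (measurable_lpNorm hp).comp_aemeasurable (aemeasurable_of_isUniform_unitBall hp (hZ n))
  refine tendstoInDistribution_of_tendsto_cdf
    (fun n => ((hm n).const_sub 1).const_mul _) fun t => ?_
  rw [cdf_expMeasure_eq one_pos]
  split_ifs with ht
  · have hlim : Tendsto (fun n : ℕ => 1 - (1 + -(t / n)) ^ n) atTop (𝓝 (1 - Real.exp (-(1 * t)))) := by
      refine (Real.tendsto_one_add_pow_exp_of_tendsto ?_).const_sub 1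
      refine tendsto_const_nhds.congr' ?_
      filter_upwards [eventually_gt_atTop 0] with n hn
      have : (n : ℝ) ≠ 0 := by positivity
      field_simp
    refine hlim.congr' ?_
    filter_upwards [eventually_gt_atTop 0, (tendsto_natCast_atTop_atTop (R := ℝ)).eventually_gt_atTop t]
      with n hn hnt
    have hn' : (0 : ℝ) < n := Nat.cast_pos.2 hn
    have hρ : 0 < 1 + -(t / n) := by
      have := (div_lt_one hn').2 hnt
      linarith
    have hρ1 : 1 + -(t / n) ≤ 1 := by
      have : 0 ≤ t / n := by positivity
      linarith
    rw [← measureReal_lpNorm_lt hp (hZ n) hρ hρ1, ← probReal_compl_eq_one_sub₀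
      (nullMeasurableSet_lt (hm n) aemeasurable_const)]
    congr 1
    ext ω
    simp only [mem_compl_iff, mem_ofPred_eq, not_lt]
    rw [← le_div_iff₀' hn']
    constructor <;> intro h <;> linarith
  -- For negative `t` the event forces a norm larger than 1, which has probability 0.
  · refine tendsto_const_nhds.congr' ?_
    filter_upwards [eventually_gt_atTop 0] with n hn
    have hn' : (0 : ℝ) < n := Nat.cast_pos.2 hn
    refine le_antisymm measureReal_nonneg ?_
    rw [← measureReal_one_lt_lpNorm hp (hZ n)]
    refine measureReal_mono fun ω hω => ?_
    simp only [mem_ofPred_eq] at hω ⊢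
    by_contra hlt
    have : 0 ≤ (n : ℝ) * (1 - lpNorm p (Z n ω)) := mul_nonneg hn'.le (by linarith)
    linarith

/-! ### Extreme values of the coordinates and the Gumbel limit -/

section Gumbel

theorem tendsto_affine_log_div_sqrt (a b : ℝ) :
    Tendsto (fun x : ℝ => (a + b * Real.log x) / √x) atTop (𝓝 0) := by
  have h1 : Tendsto (fun x : ℝ => a / √x) atTop (𝓝 0) :=
    Tendsto.const_div_atTop Real.tendsto_sqrt_atTop a
  have h2 : Tendsto (fun x : ℝ => Real.log x / √x) atTop (𝓝 0) := by
    have := (isLittleO_log_rpow_atTop (r := 1 / 2) (by norm_num)).tendsto_div_nhds_zero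
    simpa only [Real.sqrt_eq_rpow] using this
  have h := h1.add (h2.const_mul b)
  rw [mul_zero, add_zero] at h
  refine h.congr fun x => ?_
  ring

/-- The Gumbel threshold at level `s`, as a function of `x = p log n`. -/
noncomputable def gumbelThreshold (p s x : ℝ) : ℝ :=
  x ^ (1 / p - 1) * (s + (x + 1 / p * ((1 - p) * Real.log x + p * Real.log (K p))))

variable {p : ℝ}

/-- The relative correction `δ = B / x`, with `B` affine in `log x`, is written as `B / √x / √x` so
that `B / √x → 0` yields both `δ → 0` and `x δ² → 0`. -/
theorem gumbelThreshold_eq (s : ℝ) {x : ℝ} (hx : 0 < x) :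
    gumbelThreshold p s x = x ^ (1 / p) *
      (1 + (s + 1 / p * (p * Real.log (K p)) + (1 - p) / p * Real.log x) / √x / √x) := by
  have hs : √x * √x = x := Real.mul_self_sqrt hx.le
  rw [gumbelThreshold, Real.rpow_sub_one hx.ne', div_div, hs]
  field_simp
  ring

theorem tendsto_gumbelThreshold_correction (a b : ℝ) :
    Tendsto (fun x : ℝ => (a + b * Real.log x) / √x / √x) atTop (𝓝 0) := by
  have := (tendsto_affine_log_div_sqrt a b).mul
    (tendsto_inv_atTop_zero.comp Real.tendsto_sqrt_atTop)
  simpa [div_eq_mul_inv] using this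

theorem tendsto_gumbelThreshold_atTop (hp : 0 < p) (s : ℝ) :
    Tendsto (gumbelThreshold p s) atTop atTop := by
  have h1 := (tendsto_gumbelThreshold_correction (s + 1 / p * (p * Real.log (K p)))
    ((1 - p) / p)).const_add 1
  rw [add_zero] at h1
  refine ((tendsto_rpow_atTop (y := 1 / p) (by positivity)).atTop_mul_pos one_pos h1).congr' ?_
  filter_upwards [eventually_gt_atTop 0] with x hx
  rw [gumbelThreshold_eq s hx]

/-- With `t = x ^ (1/p) * (1 + δ)`, expanding `t ^ p / p` gives `x / p + B` up to a multiple of `x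
δ²`. By the choice of centering, `B` cancels `log K` and the logarithm of `x` from `t ^ (1 - p)`,
leaving `-s`. -/
theorem tendsto_gumbelThreshold_tail (hp : 0 < p) (s : ℝ) :
    Tendsto (fun x => Real.exp (x / p) * (K p * (gumbelThreshold p s x ^ (1 - p) *
      Real.exp (-(1 / p) * gumbelThreshold p s x ^ p)))) atTop (𝓝 (Real.exp (-s))) := by
  have hK := K_pos hp
  set B : ℝ → ℝ := fun x => s + 1 / p * (p * Real.log (K p)) + (1 - p) / p * Real.log x with hB
  set δ : ℝ → ℝ := fun x => B x / √x / √x with hδ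
  have hδ0 : Tendsto δ atTop (𝓝 0) := tendsto_gumbelThreshold_correction _ _
  have hBs : Tendsto (fun x => B x / √x) atTop (𝓝 0) := tendsto_affine_log_div_sqrt _ _
  obtain ⟨C, hC, ρ, hρ, hlin⟩ := exists_abs_one_add_rpow_sub_linear_le p
  have hrem : Tendsto (fun x => x * ((1 + δ x) ^ p - 1 - p * δ x)) atTop (𝓝 0) := by
    have hb : Tendsto (fun x => C * (B x / √x) ^ 2) atTop (𝓝 0) := by
      simpa using (hBs.pow 2).const_mul C
    refine squeeze_zero_norm' ?_ hb
    filter_upwards [eventually_gt_atTop 0, hδ0.abs.eventually_le_const (by rwa [abs_zero])]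
      with x hx hδx
    rw [Real.norm_eq_abs, abs_mul, abs_of_pos hx]
    refine (mul_le_mul_of_nonneg_left (hlin _ hδx) hx.le).trans (le_of_eq ?_)
    have hs : √x ^ 2 = x := Real.sq_sqrt hx.le
    have hs0 : √x ≠ 0 := (Real.sqrt_pos.2 hx).ne'
    simp only [hδ]
    rw [div_pow (B x / √x), hs]
    field_simp
  have hlog : Tendsto (fun x => Real.log (1 + δ x)) atTop (𝓝 0) := by
    have h := (hδ0.const_add 1).log (by norm_num)
    simpa using h
  have hexp : Tendsto (fun x => Real.exp (-s + (1 - p) * Real.log (1 + δ x)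
      - 1 / p * (x * ((1 + δ x) ^ p - 1 - p * δ x)))) atTop (𝓝 (Real.exp (-s))) := by
    refine (Real.continuous_exp.tendsto _).comp ?_
    simpa using ((hlog.const_mul (1 - p)).const_add (-s)).sub (hrem.const_mul (1 / p))
  refine hexp.congr' ?_
  filter_upwards [eventually_gt_atTop 0,
    hδ0.eventually_const_lt (show (-1 : ℝ) < 0 by norm_num)] with x hx hδx
  have h1 : 0 < 1 + δ x := by linarith
  have hxp : 0 < x ^ (1 / p) := by positivity
  have hs : √x * √x = x := Real.mul_self_sqrt hx.le
  have hxδ : x * δ x = B x := by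
    simp only [hδ]
    rw [div_div, hs]
    field_simp
  rw [gumbelThreshold_eq s hx]
  change _ = Real.exp (x / p) * (K p * ((x ^ (1 / p) * (1 + δ x)) ^ (1 - p) *
    Real.exp (-(1 / p) * (x ^ (1 / p) * (1 + δ x)) ^ p)))
  rw [Real.rpow_def_of_pos (mul_pos hxp h1), Real.mul_rpow hxp.le h1.le, ← Real.rpow_mul hx.le,
    one_div_mul_cancel hp.ne', Real.rpow_one]
  nth_rw 1 [← Real.exp_log hK]
  rw [← Real.exp_add, ← Real.exp_add, ← Real.exp_add, Real.log_mul hxp.ne' h1.ne',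
    Real.log_rpow hx]
  congr 1
  have e : x * ((1 + δ x) ^ p - 1 - p * δ x) = x * (1 + δ x) ^ p - x - p * B x := by
    rw [← hxδ]
    ring
  rw [e]
  simp only [hB]
  field_simp
  ring

theorem tendsto_A_div_rpow (hp : 0 < p) {r : ℝ} (hr : 0 < r) :
    Tendsto (fun n : ℕ => A p n / (n : ℝ) ^ r) atTop (𝓝 0) := by
  have hlog : Tendsto (fun n : ℕ => p * Real.log n) atTop atTop :=
    (Real.tendsto_log_atTop.comp tendsto_natCast_atTop_atTop).const_mul_atTop hp
  have h1 := ((tendsto_gumbelThreshold_correction (1 / p * (p * Real.log (K p)))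
    ((1 - p) / p)).const_add 1).comp hlog
  have h2 : Tendsto (fun n : ℕ => p * (Real.log n / (n : ℝ) ^ r)) atTop (𝓝 0) := by
    have := ((isLittleO_log_rpow_atTop hr).tendsto_div_nhds_zero.comp
      (tendsto_natCast_atTop_atTop (R := ℝ))).const_mul p
    simpa using this
  have h := h1.mul h2
  rw [mul_zero] at h
  refine h.congr' ?_
  filter_upwards [hlog.eventually_gt_atTop 0] with n hn
  have hs : √(p * Real.log n) * √(p * Real.log n) = p * Real.log n := Real.mul_self_sqrt hn.le
  have hl : Real.log n ≠ 0 := fun h => by simp [h] at hn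
  simp only [Function.comp_apply]
  rw [div_div, hs, A]
  field_simp
  ring

theorem lpNorm_top_le_iff {n : ℕ} {t : ℝ} (ht : 0 ≤ t) (x : Fin n → ℝ) :
    lpNorm ∞ x ≤ t ↔ ∀ i, |x i| ≤ t := by
  rw [lpNorm, PiLp.norm_toLp, pi_norm_le_iff_of_nonneg ht]
  rfl

theorem modelMeasure_real_lpNorm_top_le {p : ℝ≥0∞} (hp : 1 ≤ p) (n : ℕ) {t : ℝ} (ht : 0 ≤ t) :
    (modelMeasure p).real {z | lpNorm ∞ (fun i : Fin n => z.2 i) ≤ t}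
      = (coordLaw p).real {x | |x| ≤ t} ^ n := by
  have := isProbabilityMeasure_coordLaw hp
  have := isProbabilityMeasure_radialLaw hp
  have hm : MeasurableSet {x : ℝ | |x| ≤ t} := measurableSet_le (by fun_prop) (by fun_prop)
  have h : (modelMeasure p).map (fun z => (z.1, fun i : Fin n => z.2 i))
      (univ ×ˢ univ.pi fun _ => {x : ℝ | |x| ≤ t}) = coordLaw p {x | |x| ≤ t} ^ n := by
    rw [map_restrict_modelMeasure hp, Measure.prod_prod, measure_univ, one_mul, Measure.pi_pi]
    simp
  rw [Measure.map_apply (by fun_prop)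
    (MeasurableSet.univ.prod (MeasurableSet.univ_pi fun _ => hm))] at h
  simp_rw [lpNorm_top_le_iff ht]
  rw [measureReal_def, measureReal_def, ← ENNReal.toReal_pow, ← h]
  congr 2
  ext z
  simp

theorem tendstoInDistribution_max_coord {p : ℝ≥0∞} (hp : 1 ≤ p) (hp' : p ≠ ∞)
    [IsProbabilityMeasure (modelMeasure p)] :
    TendstoInDistribution (fun (n : ℕ) z =>
      lpNorm ∞ (fun i : Fin n => z.2 i) / (p.toReal * Real.log n) ^ (1 / p.toReal - 1)
        - A p.toReal n) atTop id (fun _ => modelMeasure p) gumbelMeasure := by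
  have h0 := toReal_pos_of_one_le hp hp'
  have := isProbabilityMeasure_pGaussian h0
  set r := p.toReal with hr
  have hlog : Tendsto (fun n : ℕ => r * Real.log n) atTop atTop :=
    (Real.tendsto_log_atTop.comp tendsto_natCast_atTop_atTop).const_mul_atTop h0
  have hm : ∀ n : ℕ, Measurable fun z : ℝ × (ℕ → ℝ) => lpNorm ∞ (fun i : Fin n => z.2 i) :=
    fun n => (measurable_lpNorm le_top).comp (by fun_prop)
  refine tendstoInDistribution_of_tendsto_cdf (fun n => (((hm n).div_const _).sub_const _).aemeasurable)
    fun s => ?_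
  rw [cdf_gumbelMeasure]
  have ht := (tendsto_gumbelThreshold_atTop h0 s).comp hlog
  -- At `x = r log n` the factor `exp (x / r)` is `n`, so the expected number of exceedances tends
  -- to `exp (-s)`.
  have hmain : Tendsto (fun n : ℕ => (n : ℝ) * -(K r *
      ∫ x in Ioi (gumbelThreshold r s (r * Real.log n)), Real.exp (-(1 / r) * x ^ r))) atTop
      (𝓝 (-Real.exp (-s))) := by
    have h := (((tendsto_gumbelThreshold_tail h0 s).comp hlog).mul
      ((tendsto_integral_Ioi_div h0).comp ht)).neg
    rw [mul_one] at h
    refine h.congr' ?_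
    filter_upwards [eventually_gt_atTop 0, ht.eventually_gt_atTop 0] with n hn htn
    have hn' : (0 : ℝ) < n := Nat.cast_pos.2 hn
    simp only [Function.comp_apply] at htn ⊢
    rw [mul_div_cancel_left₀ _ h0.ne', Real.exp_log hn']
    have := (Real.rpow_pos_of_pos htn (1 - r)).ne'
    field_simp
  refine (Real.tendsto_one_add_pow_exp_of_tendsto hmain).congr' ?_
  filter_upwards [hlog.eventually_gt_atTop 0, ht.eventually_ge_atTop 0] with n hL htn
  simp only [Function.comp_apply] at htn
  have hset : {z : ℝ × (ℕ → ℝ) | lpNorm ∞ (fun i : Fin n => z.2 i) /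
      (r * Real.log n) ^ (1 / r - 1) - A r n ≤ s}
      = {z | lpNorm ∞ (fun i : Fin n => z.2 i) ≤ gumbelThreshold r s (r * Real.log n)} := by
    ext z
    simp only [mem_ofPred_eq]
    rw [sub_le_iff_le_add, div_le_iff₀ (by positivity), mul_comm]
    rfl
  have hcompl : {x : ℝ | |x| ≤ gumbelThreshold r s (r * Real.log n)}
      = {x | gumbelThreshold r s (r * Real.log n) < |x|}ᶜ := by
    ext x
    simp
  rw [hset, modelMeasure_real_lpNorm_top_le hp n htn, coordLaw, if_neg hp', hcompl,
    probReal_compl_eq_one_sub (measurableSet_lt (by fun_prop) (by fun_prop)),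
    pGaussian_real_abs_gt h0 htn, sub_eq_add_neg]

/-- With `N = n ^ (1/4)` one has `√n u² = (N u)²`, so smallness of the hypothesis bounds `N |u +
w/n|`; the power is Lipschitz near 1, and `|c n| ≤ N` eventually. -/
theorem exists_forall_abs_rpow_sub_one_lt (a : ℝ) {c : ℕ → ℝ}
    (hc : Tendsto (fun n : ℕ => c n / (n : ℝ) ^ (1 / 4 : ℝ)) atTop (𝓝 0)) {ε : ℝ} (hε : 0 < ε) :
    ∃ δ > 0, ∀ᶠ n : ℕ in atTop, ∀ u w : ℝ, √n * u ^ 2 + (√(n : ℝ))⁻¹ * |w| < δ →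
      |(1 + (u + w / n)) ^ a - 1| < ε ∧ |c n * ((1 + (u + w / n)) ^ a - 1)| < ε := by
  obtain ⟨C, hC, ρ, hρ, hlip⟩ := exists_abs_one_add_rpow_sub_le a
  refine ⟨min 1 (min ((ρ / 2) ^ 2) ((ε / (4 * C)) ^ 2)), by positivity, ?_⟩
  filter_upwards [eventually_ge_atTop 1, hc.abs.eventually_le_const
    (show |(0 : ℝ)| < 1 by simp)] with n hn hA u w hz
  have hn1 : (1 : ℝ) ≤ n := by exact_mod_cast hn
  set N : ℝ := (n : ℝ) ^ (1 / 4 : ℝ) with hN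
  have hN1 : 1 ≤ N := Real.one_le_rpow hn1 (by norm_num)
  have hNs : √(n : ℝ) = N ^ 2 := by
    rw [hN, ← Real.rpow_natCast, ← Real.rpow_mul (by positivity), Real.sqrt_eq_rpow]
    norm_num
  have hNn : (n : ℝ) = N ^ 4 := by
    rw [hN, ← Real.rpow_natCast, ← Real.rpow_mul (by positivity)]
    norm_num
  set x := √(n : ℝ) * u ^ 2 + (√(n : ℝ))⁻¹ * |w| with hx
  have hx0 : 0 ≤ x := by positivity
  rw [lt_min_iff, lt_min_iff] at hz
  obtain ⟨hz1, hz2, hz3⟩ := hz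
  have hsx1 : √x ≤ 1 := Real.sqrt_le_one.2 hz1.le
  have hsx2 : √x < ρ / 2 := (Real.sqrt_lt' (by positivity)).2 hz2
  have hsx3 : √x < ε / (4 * C) := (Real.sqrt_lt' (by positivity)).2 hz3
  have hxx : √x * √x = x := Real.mul_self_sqrt hx0
  have hsx0 : 0 ≤ √x := Real.sqrt_nonneg x
  have hNu : N * |u| ≤ √x := by
    refine Real.le_sqrt_of_sq_le ?_
    rw [mul_pow, sq_abs, ← hNs]
    have : 0 ≤ (√(n : ℝ))⁻¹ * |w| := by positivity
    linarith
  have hNw : N * |w / n| ≤ √x := by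
    have h1 : N * |w / n| ≤ (√(n : ℝ))⁻¹ * |w| := by
      rw [abs_div, abs_of_nonneg (by positivity : (0 : ℝ) ≤ n), hNs, hNn, inv_mul_eq_div,
        mul_div_assoc', div_le_div_iff₀ (by positivity) (by positivity)]
      have : N ^ 3 ≤ N ^ 4 := pow_le_pow_right₀ hN1 (by norm_num)
      nlinarith [abs_nonneg w]
    have h2 : 0 ≤ √(n : ℝ) * u ^ 2 := by positivity
    nlinarith
  have hv : N * |u + w / n| ≤ 2 * √x := by
    have := mul_le_mul_of_nonneg_left (abs_add_le u (w / n)) (by positivity : 0 ≤ N)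
    linarith
  have hv1 : |u + w / n| ≤ 2 * √x := (le_mul_of_one_le_left (abs_nonneg _) hN1).trans hv
  have hl := hlip (u + w / n) (by linarith)
  have hε2 : 4 * C * √x < ε := by
    have := (lt_div_iff₀ (by positivity)).1 hsx3
    linarith
  have hCx : 0 ≤ C * √x := by positivity
  have hl2 : N * |(1 + (u + w / n)) ^ a - 1| ≤ 2 * (C * √x) := by
    refine (mul_le_mul_of_nonneg_left hl (by positivity)).trans ?_
    have := mul_le_mul_of_nonneg_left hv hC.le
    linarith
  constructor
  · have := (le_mul_of_one_le_left (abs_nonneg ((1 + (u + w / n)) ^ a - 1)) hN1).trans hl2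
    linarith
  · rw [abs_div, abs_of_pos (by positivity : 0 < N), div_le_one (by positivity)] at hA
    rw [abs_mul]
    have := (mul_le_mul_of_nonneg_right hA (abs_nonneg ((1 + (u + w / n)) ^ a - 1))).trans hl2
    linarith

theorem tendstoInMeasure_model_radius {p : ℝ≥0∞} (hp : 1 ≤ p)
    [IsProbabilityMeasure (modelMeasure p)] :
    TendstoInMeasure (modelMeasure p) (fun (n : ℕ) z =>
      √n * ((∑ k ∈ Finset.range n, |z.2 k| ^ p.toReal) / n - 1) ^ 2 + (√(n : ℝ))⁻¹ * |z.1|)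
      atTop 0 := by
  have hhm : Measurable fun x : ℝ => |x| ^ p.toReal := by fun_prop
  have h1 : TendstoInMeasure (modelMeasure p) (fun (n : ℕ) z =>
      √n * ((∑ k ∈ Finset.range n, |z.2 k| ^ p.toReal) / n - 1) ^ 2) atTop 0 := by
    have hindep : iIndepFun (fun (k : ℕ) (z : ℝ × (ℕ → ℝ)) => |z.2 k| ^ p.toReal)
        (modelMeasure p) :=
      (iIndepFun_modelMeasure hp).comp (fun _ x => |x| ^ p.toReal) fun _ => hhm
    have hident : ∀ k, IdentDistrib (fun z : ℝ × (ℕ → ℝ) => |z.2 k| ^ p.toReal)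
        (fun z => |z.2 0| ^ p.toReal) (modelMeasure p) (modelMeasure p) :=
      fun k => (identDistrib_modelMeasure hp k).comp hhm
    have hmean : ∫ z, |z.2 0| ^ p.toReal ∂modelMeasure p = 1 :=
      (integral_modelMeasure hp hhm 0).trans (integral_abs_rpow_self hp)
    exact tendstoInMeasure_sqrt_mul_sq_sub
      (memLp_modelMeasure hp hhm (memLp_abs_rpow_coordLaw hp ENNReal.toReal_nonneg) 0)
      hindep hident hmean
  exact tendstoInMeasure_zero_add h1 (tendstoInMeasure_const_mul_zero measurable_fst.abs
    ((tendsto_inv_atTop_zero.comp Real.tendsto_sqrt_atTop).comp tendsto_natCast_atTop_atTop))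

/-- Slutsky's theorem: if `U` is the centered rescaled maximum of the coordinates and `1 + ε` the
radial factor, the statistic is `(1 + ε) U + A_n ε`, where both `ε` and `A_n ε` tend to 0 in
probability. -/
theorem tendstoInDistribution_gumbel_model {p : ℝ≥0∞} (hp : 1 ≤ p) (hp' : p ≠ ∞)
    [IsProbabilityMeasure (modelMeasure p)] :
    TendstoInDistribution (fun (n : ℕ) z =>
      (n : ℝ) ^ (1 / p.toReal) / (p.toReal * Real.log n) ^ (1 / p.toReal - 1) *
        lpNorm ∞ (ballPoint p.toReal z.1 fun i : Fin n => z.2 i) - A p.toReal n)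
      atTop id (fun _ => modelMeasure p) gumbelMeasure := by
  have h0 := toReal_pos_of_one_le hp hp'
  have hU := tendstoInDistribution_max_coord hp hp'
  set r := p.toReal with hr
  set V : ℕ → ℝ × (ℕ → ℝ) → ℝ := fun n z =>
    (∑ k ∈ Finset.range n, |z.2 k| ^ r) / n + z.1 / n with hV
  have hVm : ∀ n, Measurable (V n) := fun n => by fun_prop
  have hR : TendstoInMeasure (modelMeasure p) (fun (n : ℕ) z =>
      (V n z ^ (-(1 / r)) - 1, A r n * (V n z ^ (-(1 / r)) - 1))) atTop 0 := by
    refine tendstoInMeasure_zero_of_small (tendstoInMeasure_model_radius hp) fun ε hε => ?_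
    obtain ⟨δ, hδ, hn⟩ := exists_forall_abs_rpow_sub_one_lt (-(1 / r))
      (tendsto_A_div_rpow h0 (r := 1 / 4) (by norm_num)) hε
    refine ⟨δ, hδ, ?_⟩
    filter_upwards [hn] with n hn z hz
    have hVe : 1 + ((∑ k ∈ Finset.range n, |z.2 k| ^ r) / n - 1 + z.1 / n) = V n z := by
      simp only [hV]
      ring
    have h := hn _ _ ((le_abs_self _).trans_lt hz)
    rw [hVe] at h
    rw [Prod.norm_def, max_lt_iff, Real.norm_eq_abs, Real.norm_eq_abs]
    exact h
  have hfin := hU.continuous_comp_prodMk_of_tendstoInMeasure_const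
    (g := fun x : ℝ × ℝ × ℝ => (1 + x.2.1) * x.1 + x.2.2) (by fun_prop) hR
    (fun n => by have := hVm n; fun_prop)
  refine hfin.congr (fun n => ?_) (ae_of_all _ fun x => ?_)
  · filter_upwards [ae_nonneg_modelMeasure hp] with z hz
    have hVe : V n z ^ (-(1 / r)) =
        (∑ i : Fin n, |z.2 i| ^ r + z.1) ^ (-(1 / r)) * (n : ℝ) ^ (1 / r) := by
      simp only [hV]
      rw [Finset.sum_range, ← add_div, Real.div_rpow (by positivity) (by positivity),
        Real.rpow_neg (by positivity : (0 : ℝ) ≤ n), div_inv_eq_mul]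
    rw [lpNorm_ballPoint le_top hz, hVe]
    ring
  · simp

end Gumbel

/-! ### Transfer from the model to arbitrary uniform vectors -/

theorem measurable_prodMk_restrict (n : ℕ) :
    Measurable fun z : ℝ × (ℕ → ℝ) => (z.1, fun i : Fin n => z.2 i) :=
  measurable_fst.prodMk (measurable_pi_lambda _ fun i =>
    (measurable_pi_apply (i : ℕ)).comp measurable_snd)

theorem measurable_modelPoint (p : ℝ) (n : ℕ) : Measurable fun z : ℝ × (ℕ → ℝ) =>
    ballPoint p z.1 fun i : Fin n => z.2 i := by
  have h := (measurable_ballPoint (p := p) (n := n)).comp (measurable_prodMk_restrict n)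
  exact h

section Transfer

variable {Ω : ℕ → Type*} [∀ n, MeasurableSpace (Ω n)] {P : ∀ n, Measure (Ω n)}
  [∀ n, IsProbabilityMeasure (P n)] {p : ℝ≥0∞} {Z : ∀ n, Ω n → Fin n → ℝ}

theorem TendstoInDistribution.of_model (hp : 1 ≤ p)
    (hZ : ∀ n, pdf.IsUniform (Z n) (unitBall n p) (P n) volume)
    {E : Type*} [TopologicalSpace E] [MeasurableSpace E] [OpensMeasurableSpace E]
    {μ : Measure E} [IsProbabilityMeasure μ] [IsProbabilityMeasure (modelMeasure p)]
    {g : ∀ n, (Fin n → ℝ) → E} (hg : ∀ n, Measurable (g n))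
    (h : TendstoInDistribution (fun n z => g n (ballPoint p.toReal z.1 fun i : Fin n => z.2 i))
      atTop id (fun _ => modelMeasure p) μ) :
    TendstoInDistribution (fun n ω => g n (Z n ω)) atTop id P μ := by
  exact TendstoInDistribution.comp_of_map_eq hg
    (fun n => aemeasurable_of_isUniform_unitBall hp (hZ n)) (fun n => (measurable_modelPoint p.toReal n).aemeasurable)
    (fun n => (hZ n).trans (map_ballPoint_modelMeasure hp n).symm) h

theorem posSemidef_and_tendstoInDistribution_gaussian (hp : 1 ≤ p)
    (hZ : ∀ n, pdf.IsUniform (Z n) (unitBall n p) (P n) volume)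
    {d : ℕ} {q : Fin d → ℝ≥0∞} (hq : ∀ i, 1 ≤ q i) (hq' : ∀ i, q i ≠ ∞) :
    (limitCov p q).PosSemidef ∧
    TendstoInDistribution
      (fun (n : ℕ) (ω : Ω n) => (WithLp.toLp 2 fun i =>
        √(n : ℝ) * ((n : ℝ) ^ (p⁻¹.toReal - (q i)⁻¹.toReal) *
          (lpNorm (q i) (Z n ω) / M p (q i) ^ (1 / (q i).toReal)) - 1) : EuclideanSpace ℝ (Fin d)))
      atTop id P (multivariateGaussian 0 (limitCov p q)) := by
  have hmodel := isProbabilityMeasure_modelMeasure hp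
  obtain ⟨hpsd, h⟩ := posSemidef_and_tendstoInDistribution_model hp hq hq'
  set g : ∀ n : ℕ, (Fin n → ℝ) → EuclideanSpace ℝ (Fin d) := fun n x => WithLp.toLp 2 fun i =>
    √(n : ℝ) * ((n : ℝ) ^ (p⁻¹.toReal - (q i)⁻¹.toReal) *
      (lpNorm (q i) x / M p (q i) ^ (1 / (q i).toReal)) - 1) with hg
  have hgm : ∀ n, Measurable (g n) := fun n =>
    (PiLp.continuous_toLp 2 _).measurable.comp (measurable_pi_lambda _ fun i =>
      ((((measurable_lpNorm (hq i)).div_const _).const_mul _).sub_const _).const_mul _)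
  exact ⟨hpsd, TendstoInDistribution.of_model hp hZ hgm h⟩

theorem tendstoInDistribution_gumbel (hp : 1 ≤ p) (hp' : p ≠ ∞)
    (hZ : ∀ n, pdf.IsUniform (Z n) (unitBall n p) (P n) volume) :
    TendstoInDistribution
      (fun (n : ℕ) (ω : Ω n) =>
        (n : ℝ) ^ (1 / p.toReal) / (p.toReal * Real.log n) ^ (1 / p.toReal - 1) *
          lpNorm ∞ (Z n ω) - A p.toReal n)
      atTop id P gumbelMeasure := by
  have hmodel := isProbabilityMeasure_modelMeasure hp
  have h := tendstoInDistribution_gumbel_model hp hp'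
  set g : ∀ n : ℕ, (Fin n → ℝ) → ℝ := fun n x =>
    (n : ℝ) ^ (1 / p.toReal) / (p.toReal * Real.log n) ^ (1 / p.toReal - 1) *
      lpNorm ∞ x - A p.toReal n with hg
  have hgm : ∀ n, Measurable (g n) := fun n =>
    ((measurable_lpNorm le_top).const_mul _).sub_const _
  exact TendstoInDistribution.of_model hp hZ hgm h

end Transfer

end LpBall

/-! ### The three limit theorems together -/

theorem theorem1p1 {Ω : ℕ → Type*} [∀ n, MeasurableSpace (Ω n)]
    (P : ∀ n, Measure (Ω n)) [∀ n, IsProbabilityMeasure (P n)]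
    (p : ℝ≥0∞) (hp : 1 ≤ p)
    (Z : ∀ n, Ω n → Fin n → ℝ)
    (hZ : ∀ n, pdf.IsUniform (Z n) (LpBall.unitBall n p) (P n) volume) :
    -- (a)
    (∀ (d : ℕ) (q : Fin d → ℝ≥0∞), StrictMono q → (∀ i, 1 ≤ q i) → (∀ i, q i ≠ ∞) →
      (∀ i, p ≠ q i) →
        (LpBall.limitCov p q).PosSemidef ∧
        TendstoInDistribution
          (fun (n : ℕ) (ω : Ω n) => (WithLp.toLp 2 fun i =>
            √(n : ℝ) * ((n : ℝ) ^ (p⁻¹.toReal - (q i)⁻¹.toReal) *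
              (LpBall.lpNorm (q i) (Z n ω) / LpBall.M p (q i) ^ (1 / (q i).toReal)) - 1) :
                EuclideanSpace ℝ (Fin d)))
          atTop id P (multivariateGaussian 0 (LpBall.limitCov p q)) ∧
        (p ≠ ∞ → ∀ i j, LpBall.limitCov p q i j =
          1 / ((q i).toReal * (q j).toReal) *
            (Real.Gamma (1 / p.toReal) *
                Real.Gamma (((q i).toReal + (q j).toReal + 1) / p.toReal) /
              (Real.Gamma (((q i).toReal + 1) / p.toReal) *
                Real.Gamma (((q j).toReal + 1) / p.toReal)) - 1) - 1 / p.toReal) ∧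
        (p = ∞ → ∀ i j, LpBall.limitCov p q i j =
          1 / ((q i).toReal + (q j).toReal + 1))) ∧
    -- (b)
    (∀ q : ℝ≥0∞, p = q →
      TendstoInDistribution
        (fun (n : ℕ) (ω : Ω n) => (n : ℝ) * (1 - LpBall.lpNorm q (Z n ω)))
        atTop id P (expMeasure 1)) ∧
    -- (c)
    (p ≠ ∞ →
      TendstoInDistribution
        (fun (n : ℕ) (ω : Ω n) =>
          (n : ℝ) ^ (1 / p.toReal) / (p.toReal * Real.log n) ^ (1 / p.toReal - 1) *
            LpBall.lpNorm ∞ (Z n ω) - LpBall.A p.toReal n)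
        atTop id P LpBall.gumbelMeasure) := by
  refine ⟨fun d q _ hq hq' _ => ?_, fun q hpq => ?_, fun hp' =>
    LpBall.tendstoInDistribution_gumbel hp hp' hZ⟩
  · obtain ⟨hpsd, h⟩ := LpBall.posSemidef_and_tendstoInDistribution_gaussian hp hZ hq hq'
    refine ⟨hpsd, h, fun hp' => LpBall.limitCov_eq_of_ne_top hp hp' hq hq', ?_⟩
    rintro rfl
    exact LpBall.limitCov_eq_of_top hq hq'
  · subst hpq
    exact LpBall.tendstoInDistribution_exponential hp hZ
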